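/- Let $k\ge 2$ be an even integer, let $m\ge 1$, and let $G_0$ be a connected $k$-uniform hypergraph (finite, with at least one vertex). For a $k$-uniform hypergraph $G$ with vertex set $V$, the adjacency tensor $\mathcal A(G)=(a_{i_1\ldots i_k})_{i_1,\ldots,i_k\in V}$ has the entry $a_{i_1\ldots i_k}=\frac1{(k-1)!}$ if $\{i_1,\ldots,i_k\}$ is an edge of $G$, and $0$ otherwise. An H-eigenvalue of $\mathcal A(G)$ is a real number $\lambda$ for which there is a nonzero $x\in\mathbb R^V$ with $$\sum_{i_2,\ldots,i_k\in V}a_{i\,i_2\ldots i_k}x_{i_2}\cdots x_{i_k}=\lambda x_i^{k-1}\qquad\text{for all } i\in V,$$ and $\lambda_{\min}(G)$ denotes the least H-eigenvalue of $\mathcal A(G)$. A hypertree is a connected hypergraph without cycles $v_0e_0v_1e_1\cdots v_{l-1}e_{l-1}v_0$, $l\ge2$, with distinct vertices $v_i$ and distinct edges $e_i$. A hyperstar $S_m^k$ with center $c$ is the $k$-uniform hypergraph with $m$ edges, all of which contain $c$ and no two of which share another vertex, and with no vertices besides $c$ and those on the edges. For hypergraphs $G_1,G_2$ that have exactly the vertex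 $u$ in common, $G_1(u)\diamond G_2(u)$ denotes their union. Let $\mathcal T_m(G_0)$ be the class of hypergraphs $G$ containing $G_0$ that are obtained from $G_0$ by attaching finitely many $k$-uniform hypertrees at vertices of $G_0$ (each time identifying a vertex of the hypertree with a vertex of $G_0$, all other vertices being new), such that $G$ has exactly $m$ edges more than $G_0$. Let $G\in\mathcal T_m(G_0)$ satisfy $\lambda_{\min}(G)\le\lambda_{\min}(G')$ for all $G'\in\mathcal T_m(G_0)$. (1) If $G_0$ has at least one edge, then there is a unique vertex $u$ of $G_0$ such that $G=G_0(u)\diamond S_m^k(u)$, where $S_m^k$ is a hyperstar with center $u$. (2) If $G_0$ has no edges, i.e. is a single vertex, then $G$ is a hyperstar $S_m^k$ (so that $G$ is isomorphic to $G_0(u)\diamond S_m^k(u)$ with $u$ the only vertex of $G_0$). -/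

import Mathlib

namespace Hypergraph

/-! ### Tensors and H-eigenvalues -/

/-- For a tensor `A` of order `k` indexed by `V` and a vector `x`, the vector `A x^{k-1}`:
`(A x^{k-1})_v = ∑_{i₂, …, i_k} a_{v i₂ … i_k} x_{i₂} ⋯ x_{i_k}`.
The position `0 : Fin k` is the first index. The sum is a finite sum when `V` is finite. -/
noncomputable def tensorApply {V : Type*} {k : ℕ} [NeZero k]
    (A : (Fin k → V) → ℝ) (x : V → ℝ) (v : V) : ℝ :=
  ∑ᶠ i ∈ {i : Fin k → V | i 0 = v}, A i * ∏ j ∈ Finset.univ.erase (0 : Fin k), x (i j)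

/-- `lam` is an H-eigenvalue of the tensor `A`: there is a real `x ≠ 0` with
`A x^{k-1} = lam x^{[k-1]}`. -/
def IsHEigenvalue {V : Type*} {k : ℕ} [NeZero k] (A : (Fin k → V) → ℝ) (lam : ℝ) : Prop :=
  ∃ x : V → ℝ, x ≠ 0 ∧ ∀ v, tensorApply A x v = lam * x v ^ (k - 1)

variable {α : Type*}

open scoped Classical in
/-- The adjacency tensor of order `k` of a hypergraph, with entry `1/(k-1)!` at
`(i₁, …, i_k)` if `{i₁, …, i_k}` is an edge, and `0` otherwise. -/
noncomputable def adjTensor (G : Hypergraph α) (k : ℕ) (i : Fin k → G.vertexSet) : ℝ :=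
  if Set.range (fun j => (i j : α)) ∈ G.edgeSet then 1 / ((k - 1).factorial : ℝ) else 0

/-- The least H-eigenvalue of (the adjacency tensor of) `G`. For `k` even and `G` finite with at
least one vertex, the set of H-eigenvalues is nonempty and finite, so the infimum is a minimum. -/
noncomputable def leastHEigenvalue (k : ℕ) [NeZero k] (G : Hypergraph α) : ℝ :=
  sInf {lam : ℝ | IsHEigenvalue (G.adjTensor k) lam}

/-! ### Uniform hypergraphs, hypertrees, hyperstars -/

/-- All edges have exactly `k` vertices (used with `0 < k`, where it forces finite edges). -/
def IsUniform (k : ℕ) (G : Hypergraph α) : Prop :=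
  ∀ e ∈ G.edgeSet, e.ncard = k

/-- `G` has a vertex, and any two vertices are joined by a walk. -/
def IsConnected (G : Hypergraph α) : Prop :=
  G.vertexSet.Nonempty ∧
    ∀ x ∈ G.vertexSet, ∀ y ∈ G.vertexSet, Relation.ReflTransGen G.Adj x y

/-- `G` has no (Berge) cycle `v₀ e₀ v₁ e₁ … v_{l-1} e_{l-1} v₀`, with `l = n + 2 ≥ 2` distinct
vertices and `l` distinct edges, `v_i, v_{i+1} ∈ e_i`. The addition `i + 1` in `Fin (n + 2)`
is modulo `n + 2`. -/
def IsAcyclic (G : Hypergraph α) : Prop :=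
  ¬ ∃ (n : ℕ) (v : Fin (n + 2) → α) (e : Fin (n + 2) → Set α),
    Function.Injective v ∧ Function.Injective e ∧
      ∀ i, e i ∈ G.edgeSet ∧ v i ∈ e i ∧ v (i + 1) ∈ e i

/-- A finite `k`-uniform hypertree (possibly a single vertex). -/
structure IsHypertree (k : ℕ) (T : Hypergraph α) : Prop where
  finite : T.vertexSet.Finite
  uniform : T.IsUniform k
  connected : T.IsConnected
  acyclic : T.IsAcyclic

/-- `S` is a hyperstar `S_m^k` with center `c`, i.e. the `k`-th power of a star with `m` edges:
the `m` edges have `k` vertices, all contain `c`, pairwise share no other vertex, and every vertex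
other than `c` lies on an edge. -/
structure IsHyperstar (k m : ℕ) (c : α) (S : Hypergraph α) : Prop where
  finite : S.vertexSet.Finite
  uniform : S.IsUniform k
  card_edges : S.edgeSet.ncard = m
  center_mem : ∀ e ∈ S.edgeSet, c ∈ e
  inter_eq : ∀ e ∈ S.edgeSet, ∀ f ∈ S.edgeSet, e ≠ f → e ∩ f = {c}
  vertexSet_eq : S.vertexSet = insert c (⋃₀ S.edgeSet)

/-! ### Coalescence and attaching hypertrees -/

/-- `G = G₁(u) ◇ G₂(u)`: `G` is the union of `G₁` and `G₂`, which share exactly the vertex `u`. -/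
structure IsCoalescence (G₁ G₂ : Hypergraph α) (u : α) (G : Hypergraph α) : Prop where
  inter_eq : G₁.vertexSet ∩ G₂.vertexSet = {u}
  vertexSet_eq : G.vertexSet = G₁.vertexSet ∪ G₂.vertexSet
  edgeSet_eq : G.edgeSet = G₁.edgeSet ∪ G₂.edgeSet

/-- `G` is obtained from `G₀` by attaching finitely many `k`-uniform hypertrees `T i`, each one by
identifying one of its vertices with a vertex `r i` of `G₀` (several hypertrees may be attached at
the same vertex); apart from these identifications all pieces are vertex-disjoint. -/
def IsTreeAttachment (k : ℕ) (G₀ G : Hypergraph α) : Prop :=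
  ∃ (n : ℕ) (T : Fin n → Hypergraph α) (r : Fin n → α),
    (∀ i, (T i).IsHypertree k) ∧
    (∀ i, G₀.vertexSet ∩ (T i).vertexSet = {r i}) ∧
    (∀ i j, i ≠ j → (T i).vertexSet ∩ (T j).vertexSet ⊆ {r i} ∩ {r j}) ∧
    G.vertexSet = G₀.vertexSet ∪ ⋃ i, (T i).vertexSet ∧
    G.edgeSet = G₀.edgeSet ∪ ⋃ i, (T i).edgeSet

/-- The class `𝒯_m(G₀)`, realized by hypergraphs that contain the given copy of `G₀`. -/
def attachmentClass (k m : ℕ) (G₀ : Hypergraph α) : Set (Hypergraph α) :=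
  {G | IsTreeAttachment k G₀ G ∧ G.edgeSet.ncard = G₀.edgeSet.ncard + m}

/-- `G` minimizes the least H-eigenvalue in the class `C`. -/
def IsMinimizing (k : ℕ) [NeZero k] (C : Set (Hypergraph α)) (G : Hypergraph α) : Prop :=
  G ∈ C ∧ ∀ G' ∈ C, leastHEigenvalue k G ≤ leastHEigenvalue k G'

end Hypergraph

/-!
For even `k` the least H-eigenvalue of a `k`-uniform hypergraph is the minimum of the Rayleigh
quotient `k ∑_e x^e / ∑_v x_v^k`, where `x^e = ∏_{v ∈ e} x_v` (`leastHEigenvalue_spec`), so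
hypergraphs can be compared by test vectors.

Let `x` be a minimizer for the minimizing `G`, and let `q` be a vertex where `|x|` is largest,
chosen in `G₀` if possible. A hypertree can be rooted at any of its vertices
(`IsHypertree.exists_isParentMap`). Root each attached tree at its vertex in `G₀`, and set `c = q`;
but if `q` is not in `G₀`, root the tree that contains `q` at `q`, and let `c` be the vertex of `G₀`
where this tree is attached. Every tree edge `e` then has a parent `p(e)`, and its other vertices,
the children, belong to no other edge as children. Replace the parents of all tree edges by `q` and
exchange the names of `c` and `q`: this gives `G₀` with a hyperstar attached at `c`, which is again
in the class. Let `y` be `x` with the values at `c` and `q` exchanged and with suitable signs: a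
free sign in each star edge makes its product nonpositive, and the sign of `y_c` makes the
contribution of `G₀`, which is affine in `y_c`, as small as possible. As `|x_q|` is maximal, neither
the contribution of a tree edge nor that of `G₀` increases, while `∑ x_v^k` does not change. By
minimality of `G` all these contributions agree and `y` is a minimizer for the star
(`IsRootedAttachment.exists_star_vector`).

The eigenvalue equation of the star at `c` involves all star edges, that of `G` at `q` only the tree
edges through `q`. Since all these terms are negative (a minimizer that is nonzero at the center
vanishes nowhere on the star, `IsRootedAttachment.prod_starEdge_ne_zero`), every tree edge contains
`q` (`IsRootedAttachment.root_mem_of_le`), so the tree edges form a hyperstar with center `q`. If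
`q` is not in `G₀`, then `|x_q| > |x_c|`, and equality forces the derivative of the form of `G₀` at
`c` to vanish; then setting `x` to zero on `G₀` except at `c` gives another minimizer, which is
impossible if `c` lies on an edge of `G₀` (`IsRootedAttachment.center_isolated`). So `G₀` is a
single vertex.
-/

namespace Hypergraph

/-! ### The Rayleigh quotient of a uniform hypergraph -/

variable {α : Type*}

/-- The edge polynomial `∑_{e ∈ E} ∏_{v ∈ e} x_v`; `k` times it is the form `𝒜 x^k` of the adjacency
tensor of a `k`-uniform hypergraph with edge set `E`. -/
def edgeSum (E : Finset (Finset α)) (x : α → ℝ) : ℝ := ∑ e ∈ E, ∏ v ∈ e, x v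

/-- `lam` is a lower bound for the Rayleigh quotient `k ∑_e x^e / ∑_v x_v^k` of the hypergraph with
vertex set `V` and edge set `E`. -/
def IsRayleighBound (k : ℕ) (V : Finset α) (E : Finset (Finset α)) (lam : ℝ) : Prop :=
  ∀ x : α → ℝ, lam * ∑ v ∈ V, x v ^ k ≤ k * edgeSum E x

/-- The vector `x` attains the value `lam` of the Rayleigh quotient. The zero vector is allowed. -/
def AttainsRayleigh (k : ℕ) (V : Finset α) (E : Finset (Finset α)) (lam : ℝ) (x : α → ℝ) : Prop :=
  lam * ∑ v ∈ V, x v ^ k = k * edgeSum E x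

section Rayleigh

variable {k : ℕ} {V : Finset α} {E : Finset (Finset α)} {lam : ℝ}

lemma edgeSum_smul (hcard : ∀ e ∈ E, e.card = k) (r : ℝ) (x : α → ℝ) :
    edgeSum E (fun v => r * x v) = r ^ k * edgeSum E x := by
  unfold edgeSum
  rw [Finset.mul_sum]
  refine Finset.sum_congr rfl fun e he => ?_
  rw [Finset.prod_mul_distrib, Finset.prod_const, hcard e he]

lemma edgeSum_congr (hV : ∀ e ∈ E, e ⊆ V) {x y : α → ℝ} (h : ∀ v ∈ V, x v = y v) :
    edgeSum E x = edgeSum E y :=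
  Finset.sum_congr rfl fun e he => Finset.prod_congr rfl fun v hv => h v (hV e he hv)

variable [DecidableEq α]

lemma edgeSum_update (E : Finset (Finset α)) (x : α → ℝ) (v : α) (t : ℝ) :
    edgeSum E (Function.update x v t) =
      t * (∑ e ∈ E with v ∈ e, ∏ w ∈ e.erase v, x w) + ∑ e ∈ E with v ∉ e, ∏ w ∈ e, x w := by
  unfold edgeSum
  rw [← Finset.sum_filter_add_sum_filter_not E (fun e => v ∈ e), Finset.mul_sum]
  congr 1
  · refine Finset.sum_congr rfl fun e he => ?_
    rw [← Finset.mul_prod_erase e _ (Finset.mem_filter.1 he).2, Function.update_self]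
    congr 1
    exact Finset.prod_congr rfl fun w hw => Function.update_of_ne (Finset.ne_of_mem_erase hw) _ _
  · refine Finset.sum_congr rfl fun e he => Finset.prod_congr rfl fun w hw => ?_
    refine Function.update_of_ne ?_ _ _
    rintro rfl
    exact (Finset.mem_filter.1 he).2 hw

/-- First-order condition: a minimizer of the Rayleigh quotient satisfies the eigenvalue
equations. -/
lemma AttainsRayleigh.eigen (hk : k ≠ 0) (hb : IsRayleighBound k V E lam) {x : α → ℝ}
    (hx : AttainsRayleigh k V E lam x) {v : α} (hv : v ∈ V) :
    lam * x v ^ (k - 1) = ∑ e ∈ E with v ∈ e, ∏ w ∈ e.erase v, x w := by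
  set B := ∑ e ∈ E with v ∈ e, ∏ w ∈ e.erase v, x w with hB
  set A := ∑ e ∈ E with v ∉ e, ∏ w ∈ e, x w with hA
  set C := ∑ w ∈ V.erase v, x w ^ k with hC
  have hsum : ∀ t, ∑ w ∈ V, Function.update x v t w ^ k = t ^ k + C := by
    intro t
    rw [← Finset.add_sum_erase V _ hv, Function.update_self]
    congr 1
    exact Finset.sum_congr rfl fun w hw => by
      rw [Function.update_of_ne (Finset.ne_of_mem_erase hw)]
  let g : ℝ → ℝ := fun t => k * (t * B + A) - lam * (t ^ k + C)
  have hg : ∀ t, 0 ≤ g t := by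
    intro t
    have h := hb (Function.update x v t)
    rw [hsum, edgeSum_update] at h
    exact sub_nonneg.2 h
  have hg0 : g (x v) = 0 := by
    have h := hx
    unfold AttainsRayleigh at h
    rw [← Function.update_eq_self v x, hsum, edgeSum_update] at h
    exact sub_eq_zero.2 h.symm
  have hmin : IsLocalMin g (x v) := Filter.Eventually.of_forall fun t => by
    rw [hg0]; exact hg t
  have hd : HasDerivAt g (k * (1 * B) - lam * (k * x v ^ (k - 1))) (x v) := by
    refine HasDerivAt.sub ?_ ?_
    · exact (((hasDerivAt_id (x v)).mul_const B).add_const A).const_mul (k : ℝ)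
    · exact ((hasDerivAt_pow k (x v)).add_const C).const_mul lam
  have h0 := hmin.hasDerivAt_eq_zero hd
  have hk' : (k : ℝ) ≠ 0 := Nat.cast_ne_zero.2 hk
  apply mul_left_cancel₀ hk'
  linarith

lemma AttainsRayleigh.eigen_mul (hk : k ≠ 0) (hb : IsRayleighBound k V E lam) {x : α → ℝ}
    (hx : AttainsRayleigh k V E lam x) {v : α} (hv : v ∈ V) :
    lam * x v ^ k = ∑ e ∈ E with v ∈ e, ∏ w ∈ e, x w := by
  have h := hx.eigen hk hb hv
  obtain ⟨n, rfl⟩ := Nat.exists_eq_succ_of_ne_zero hk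
  rw [Nat.succ_sub_one] at h
  rw [pow_succ, ← mul_assoc, h, Finset.sum_mul]
  exact Finset.sum_congr rfl fun e he => Finset.prod_erase_mul e _ (Finset.mem_filter.1 he).2

/-- A minimizer that is nonzero at one vertex `c` of an edge `e` does not vanish on all of
`e \ {c}`, provided that the other edges through `e \ {c}` also have a zero outside `e`. Otherwise
giving the vertices of `e \ {c}` the values `±t` lowers the form by a multiple of `t ^ (k - 1)`, but
raises `∑ x_v ^ k` only by a multiple of `t ^ k`. -/
lemma AttainsRayleigh.not_vanish (hk : Even k) (hk2 : 2 ≤ k) (hb : IsRayleighBound k V E lam)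
    {y : α → ℝ} (hy : AttainsRayleigh k V E lam y) {e : Finset α} (he : e ∈ E) (heV : e ⊆ V)
    (hcard : e.card = k) {c : α} (hc : c ∈ e) (hyc : y c ≠ 0)
    (hE : ∀ f ∈ E, f ≠ e → (∃ w ∈ f, w ∈ e ∧ w ≠ c) → ∃ v ∈ f, v ∉ e ∧ y v = 0) :
    ∃ v ∈ e, v ≠ c ∧ y v ≠ 0 := by
  by_contra! hzero
  have hD : (e.erase c).card = k - 1 := by rw [Finset.card_erase_of_mem hc, hcard]
  obtain ⟨w₀, hw₀⟩ : (e.erase c).Nonempty := Finset.card_pos.1 (by omega)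
  obtain ⟨s, hs, hs'⟩ : ∃ s : ℝ, s ^ k = 1 ∧ y c * s = -|y c| := by
    rcases le_total 0 (y c) with h | h
    · exact ⟨-1, hk.neg_one_pow, by rw [abs_of_nonneg h]; ring⟩
    · exact ⟨1, one_pow k, by rw [abs_of_nonpos h]; ring⟩
  -- The test vector, with signs chosen to make the product over `e` negative.
  let z : ℝ → α → ℝ := fun t v => if v ∈ e.erase c then (if v = w₀ then s * t else t) else y v
  have hz_out : ∀ t v, v ∉ e.erase c → z t v = y v := fun t v hv => if_neg hv
  have hz_e : ∀ t, ∏ v ∈ e, z t v = -|y c| * t ^ (k - 1) := by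
    intro t
    rw [← Finset.mul_prod_erase e _ hc, ← Finset.mul_prod_erase _ _ hw₀,
      hz_out t c (by simp)]
    have h1 : z t w₀ = s * t := by simp only [z, if_pos hw₀, if_true]
    have h2 : ∏ v ∈ (e.erase c).erase w₀, z t v = t ^ (k - 2) := by
      rw [Finset.prod_congr rfl (g := fun _ => t), Finset.prod_const,
        Finset.card_erase_of_mem hw₀, hD]
      · rfl
      · intro v hv
        simp only [z]
        rw [if_pos (Finset.mem_of_mem_erase hv), if_neg (Finset.ne_of_mem_erase hv)]
    rw [h1, h2, show k - 1 = (k - 2) + 1 by omega, pow_succ, ← hs']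
    ring
  have hy_e : ∏ v ∈ e, y v = 0 :=
    Finset.prod_eq_zero (Finset.mem_of_mem_erase hw₀)
      (hzero w₀ (Finset.mem_of_mem_erase hw₀) (Finset.ne_of_mem_erase hw₀))
  have hz_f : ∀ t, ∀ f ∈ E.erase e, ∏ v ∈ f, z t v = ∏ v ∈ f, y v := by
    intro t f hf
    by_cases h : ∃ w ∈ f, w ∈ e ∧ w ≠ c
    · obtain ⟨v, hvf, hve, hv0⟩ := hE f (Finset.mem_of_mem_erase hf) (Finset.ne_of_mem_erase hf) h
      rw [Finset.prod_eq_zero hvf hv0, Finset.prod_eq_zero hvf]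
      rw [hz_out t v fun h => hve (Finset.mem_of_mem_erase h), hv0]
    · push Not at h
      refine Finset.prod_congr rfl fun v hv => hz_out t v fun hve => ?_
      exact Finset.ne_of_mem_erase hve (h v hv (Finset.mem_of_mem_erase hve))
  have hz_sum : ∀ t, edgeSum E (z t) = edgeSum E y - |y c| * t ^ (k - 1) := by
    intro t
    unfold edgeSum
    rw [← Finset.add_sum_erase E _ he, ← Finset.add_sum_erase E (fun e => ∏ v ∈ e, y v) he,
      hz_e, hy_e, Finset.sum_congr rfl (hz_f t)]
    ring
  have hz_norm : ∀ t, ∑ v ∈ V, z t v ^ k = ∑ v ∈ V, y v ^ k + (k - 1 : ℕ) * t ^ k := by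
    intro t
    have hsub : e.erase c ⊆ V := (Finset.erase_subset _ _).trans heV
    rw [← Finset.sum_sdiff hsub, ← Finset.sum_sdiff hsub (f := fun v => y v ^ k)]
    have h1 : ∑ v ∈ V \ e.erase c, z t v ^ k = ∑ v ∈ V \ e.erase c, y v ^ k :=
      Finset.sum_congr rfl fun v hv => by rw [hz_out t v (Finset.mem_sdiff.1 hv).2]
    have h2 : ∑ v ∈ e.erase c, z t v ^ k = (k - 1 : ℕ) * t ^ k := by
      rw [Finset.sum_congr rfl (g := fun _ => t ^ k), Finset.sum_const, hD, nsmul_eq_mul]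
      intro v hv
      simp only [z, if_pos hv]
      split_ifs
      · rw [mul_pow, hs, one_mul]
      · rfl
    have h3 : ∑ v ∈ e.erase c, y v ^ k = 0 := Finset.sum_eq_zero fun v hv => by
      rw [hzero v (Finset.mem_of_mem_erase hv) (Finset.ne_of_mem_erase hv),
        zero_pow (by omega)]
    rw [h1, h2, h3, add_zero]
  have hk0 : (0 : ℝ) < k := Nat.cast_pos.2 (by omega)
  have key : ∀ t : ℝ, 0 < t → k * |y c| ≤ -lam * (k - 1 : ℕ) * t := by
    intro t ht
    have h := hb (z t)
    rw [hz_sum, hz_norm, mul_add, hy] at h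
    have hp : 0 < t ^ (k - 1) := pow_pos ht _
    have : t ^ k = t ^ (k - 1) * t := by rw [← pow_succ]; congr 1; omega
    rw [this] at h
    refine le_of_mul_le_mul_right ?_ hp
    nlinarith
  have hpos : 0 < k * |y c| := mul_pos hk0 (abs_pos.2 hyc)
  have h1 := key 1 one_pos
  set M := -lam * ((k - 1 : ℕ) : ℝ) with hM
  have hMpos : 0 < M := by linarith
  have h2 := key (k * |y c| / (2 * M)) (by positivity)
  have h3 : M * (k * |y c| / (2 * M)) = k * |y c| / 2 := by field_simp
  linarith

/-- A hypergraph with an edge has a negative least eigenvalue. -/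
lemma IsRayleighBound.neg (hk : Even k) (hk2 : 2 ≤ k) (hb : IsRayleighBound k V E lam)
    (hcard : ∀ e ∈ E, e.card = k) (hE : E.Nonempty) : lam < 0 := by
  obtain ⟨e, he⟩ := hE
  obtain ⟨w₀, hw₀⟩ : e.Nonempty := Finset.card_pos.1 (by rw [hcard e he]; omega)
  let z : α → ℝ := fun v => if v ∈ e then (if v = w₀ then -1 else 1) else 0
  have hz_e : ∏ v ∈ e, z v = -1 := by
    rw [← Finset.mul_prod_erase e _ hw₀, Finset.prod_eq_one]
    · simp [z, hw₀]
    · intro v hv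
      simp only [z]
      rw [if_pos (Finset.mem_of_mem_erase hv), if_neg (Finset.ne_of_mem_erase hv)]
  have hz_sum : edgeSum E z = -1 := by
    unfold edgeSum
    rw [Finset.sum_eq_single_of_mem e he, hz_e]
    intro f hf hfe
    obtain ⟨v, hvf, hve⟩ : ∃ v ∈ f, v ∉ e := by
      by_contra! h
      exact hfe (Finset.eq_of_subset_of_card_le h (by rw [hcard e he, hcard f hf]))
    exact Finset.prod_eq_zero hvf (if_neg hve)
  have h := hb z
  rw [hz_sum] at h
  have hk0 : (0 : ℝ) < k := Nat.cast_pos.2 (by omega)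
  have hn : 0 ≤ ∑ v ∈ V, z v ^ k := Finset.sum_nonneg fun v _ => hk.pow_nonneg _
  by_contra! hlam
  nlinarith [mul_nonneg hlam hn]

/-- The Rayleigh quotient of a finite uniform hypergraph has a minimum, attained at a nonzero
vector, because the `ℓ^k` unit sphere is compact. -/
lemma exists_min_rayleigh (hk : Even k) (hk0 : k ≠ 0) (hV : ∀ e ∈ E, e ⊆ V)
    (hcard : ∀ e ∈ E, e.card = k) (hne : V.Nonempty) :
    ∃ lam, IsRayleighBound k V E lam ∧
      ∃ x, (∃ v ∈ V, x v ≠ 0) ∧ AttainsRayleigh k V E lam x := by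
  let ext : (V → ℝ) → α → ℝ := fun x v => if h : v ∈ V then x ⟨v, h⟩ else 0
  have hext : ∀ (x : V → ℝ) (v : V), ext x v = x v := fun x v => by simp [ext]
  have hsum : ∀ x : V → ℝ, ∑ v ∈ V, ext x v ^ k = ∑ v : V, x v ^ k := fun x => by
    rw [← Finset.sum_coe_sort V]
    exact Finset.sum_congr rfl fun v _ => by rw [hext]
  let K : Set (V → ℝ) := {x | ∑ v : V, x v ^ k = 1}
  have hKc : IsCompact K := by
    refine Metric.isCompact_of_isClosed_isBounded ?_ ?_
    · exact isClosed_eq (by fun_prop) continuous_const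
    · refine (Metric.isBounded_closedBall (x := (0 : V → ℝ)) (r := 1)).subset fun x hx => ?_
      rw [mem_closedBall_zero_iff, pi_norm_le_iff_of_nonneg zero_le_one]
      intro v
      have h1 : x v ^ k ≤ 1 := by
        rw [← (show ∑ v : V, x v ^ k = 1 from hx)]
        exact Finset.single_le_sum (f := fun v => x v ^ k)
          (fun v _ => hk.pow_nonneg (x v)) (Finset.mem_univ v)
      rw [Real.norm_eq_abs]
      rw [← hk.pow_abs] at h1
      exact (pow_le_one_iff_of_nonneg (abs_nonneg _) hk0).1 h1
  have hKne : K.Nonempty := by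
    obtain ⟨v, hv⟩ := hne
    refine ⟨Pi.single ⟨v, hv⟩ 1, ?_⟩
    show ∑ w : V, (Pi.single (⟨v, hv⟩ : V) (1 : ℝ) : V → ℝ) w ^ k = 1
    rw [Finset.sum_eq_single_of_mem (⟨v, hv⟩ : V) (Finset.mem_univ _)]
    · simp
    · intro w _ hw
      rw [Pi.single_eq_of_ne hw, zero_pow hk0]
  have hcont : Continuous fun x : V → ℝ => (k : ℝ) * edgeSum E (ext x) := by
    unfold edgeSum
    refine continuous_const.mul (continuous_finsetSum _ fun e _ => continuous_finsetProd _ ?_)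
    intro v _
    by_cases h : v ∈ V
    · simp only [ext, dif_pos h]; fun_prop
    · simp only [ext, dif_neg h]; fun_prop
  obtain ⟨x₀, hx₀, hmin⟩ := hKc.exists_isMinOn hKne hcont.continuousOn
  have hx₀' : ∑ v : V, x₀ v ^ k = 1 := hx₀
  refine ⟨k * edgeSum E (ext x₀), ?_, ext x₀, ?_, ?_⟩
  · intro x
    set N := ∑ v ∈ V, x v ^ k with hN
    have hN0 : 0 ≤ N := Finset.sum_nonneg fun v _ => hk.pow_nonneg _
    rcases hN0.eq_or_lt with h | h
    · have hx0 : ∀ v ∈ V, x v = 0 := fun v hv =>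
        (pow_eq_zero_iff hk0).1
          ((Finset.sum_eq_zero_iff_of_nonneg fun v _ => hk.pow_nonneg (x v)).1 h.symm v hv)
      have : edgeSum E x = 0 := Finset.sum_eq_zero fun e he => by
        obtain ⟨v, hv⟩ : e.Nonempty := Finset.card_pos.1 (by rw [hcard e he]; omega)
        exact Finset.prod_eq_zero hv (hx0 v (hV e he hv))
      rw [← h, this]; simp
    · -- Rescale `x` to the unit sphere.
      obtain ⟨r, hr, hrk⟩ : ∃ r : ℝ, 0 < r ∧ r ^ k = N :=
        ⟨N ^ (k⁻¹ : ℝ), Real.rpow_pos_of_pos h _, Real.rpow_inv_natCast_pow hN0 hk0⟩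
      let y : V → ℝ := fun v => r⁻¹ * x v
      have hy : y ∈ K := by
        show ∑ v : V, (r⁻¹ * x v) ^ k = 1
        simp_rw [mul_pow]
        rw [← Finset.mul_sum, Finset.sum_coe_sort V (fun v => x v ^ k), ← hN, inv_pow, hrk]
        exact inv_mul_cancel₀ h.ne'
      have h1 : k * edgeSum E (ext x₀) ≤ k * edgeSum E (ext y) := hmin hy
      have h2 : edgeSum E (ext y) = (r⁻¹) ^ k * edgeSum E x := by
        rw [← edgeSum_smul hcard]
        exact edgeSum_congr hV fun v hv => hext y ⟨v, hv⟩
      rw [h2, inv_pow, hrk] at h1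
      calc k * edgeSum E (ext x₀) * N ≤ (k * (N⁻¹ * edgeSum E x)) * N :=
            mul_le_mul_of_nonneg_right h1 hN0
        _ = k * edgeSum E x := by field_simp
  · by_contra! h
    have : ∑ v : V, x₀ v ^ k = 0 := Finset.sum_eq_zero fun v _ => by
      rw [← hext x₀ v, h v v.2, zero_pow hk0]
    rw [this] at hx₀'
    exact zero_ne_one hx₀'
  · unfold AttainsRayleigh
    rw [hsum, hx₀', mul_one]

end Rayleigh

/-! ### The least H-eigenvalue as a minimum -/

/-- The finite set `V` and the finite family `E` of finite sets are the vertices and edges of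
`G`. -/
structure IsModel (G : Hypergraph α) (V : Finset α) (E : Finset (Finset α)) : Prop where
  vertexSet_eq : G.vertexSet = V
  mem_edgeSet : ∀ s : Set α, s ∈ G.edgeSet ↔ ∃ e ∈ E, (e : Set α) = s

lemma exists_isModel {G : Hypergraph α} (hG : G.vertexSet.Finite) :
    ∃ V E, IsModel G V E := by
  classical
  refine ⟨hG.toFinset, {e ∈ hG.toFinset.powerset | (e : Set α) ∈ G.edgeSet}, by simp, fun s => ?_⟩
  constructor
  · intro hs
    have hsub : s ⊆ G.vertexSet := subset_vertexSet_of_mem_edgeSet hs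
    refine ⟨(hG.subset hsub).toFinset, ?_, by simp⟩
    simp [hs, hsub]
  · rintro ⟨e, he, rfl⟩
    exact (Finset.mem_filter.1 he).2

lemma IsModel.coe_mem {G : Hypergraph α} {V E} (h : IsModel G V E) {e : Finset α} :
    (e : Set α) ∈ G.edgeSet ↔ e ∈ E := by
  rw [h.mem_edgeSet]
  constructor
  · rintro ⟨f, hf, hfe⟩
    rwa [← Finset.coe_injective hfe]
  · exact fun he => ⟨e, he, rfl⟩

lemma IsModel.subset {G : Hypergraph α} {V E} (h : IsModel G V E) : ∀ e ∈ E, e ⊆ V := by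
  intro e he
  have h1 := subset_vertexSet_of_mem_edgeSet (h.coe_mem.2 he)
  rw [h.vertexSet_eq] at h1
  exact_mod_cast h1

lemma IsModel.card {G : Hypergraph α} {V E k} (h : IsModel G V E) (hu : G.IsUniform k) :
    ∀ e ∈ E, e.card = k := fun e he => by
  rw [← hu e (h.coe_mem.2 he), Set.ncard_coe_finset]

lemma IsModel.ncard_edgeSet {G : Hypergraph α} {V E} (h : IsModel G V E) :
    G.edgeSet.ncard = E.card := by
  have : G.edgeSet = (fun e : Finset α => (e : Set α)) '' (E : Set (Finset α)) := by
    ext s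
    rw [h.mem_edgeSet]
    rfl
  rw [this, Set.ncard_image_of_injective _ Finset.coe_injective, Set.ncard_coe_finset]

/-- There are `n!` ways of listing a set of `n + 1` elements that start with a given element. -/
lemma card_listings {W : Type*} [Fintype W] [DecidableEq W] {n : ℕ} {e : Finset W}
    (he : e.card = n + 1) {v : W} (hv : v ∈ e) :
    (Finset.univ.filter fun i : Fin (n + 1) → W => i 0 = v ∧ Finset.univ.image i = e).card =
      n.factorial := by
  have hcard : Fintype.card (e.erase v) = n := by
    rw [Fintype.card_coe, Finset.card_erase_of_mem hv, he, Nat.add_sub_cancel]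
  have hcard' : Fintype.card (Fin n ≃ (e.erase v)) = n.factorial := by
    rw [Fintype.card_equiv (Fintype.equivFinOfCardEq hcard).symm, Fintype.card_fin]
  rw [← hcard', ← Finset.card_univ]
  symm
  refine Finset.card_bij (fun g _ => Fin.cons v fun j => (g j : W)) ?_ ?_ ?_
  · intro g _
    rw [Finset.mem_filter]
    refine ⟨Finset.mem_univ _, Fin.cons_zero _ _, ?_⟩
    ext w
    rw [Finset.mem_image]
    constructor
    · rintro ⟨j, -, rfl⟩
      refine Fin.cases ?_ (fun j => ?_) j
      · rwa [Fin.cons_zero]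
      · rw [Fin.cons_succ]
        exact Finset.mem_of_mem_erase (g j).2
    · intro hw
      by_cases hwv : w = v
      · exact ⟨0, Finset.mem_univ _, by rw [Fin.cons_zero, hwv]⟩
      · exact ⟨(g.symm ⟨w, Finset.mem_erase.2 ⟨hwv, hw⟩⟩).succ, Finset.mem_univ _, by simp⟩
  · intro g _ g' _ h
    have h' := Fin.cons_right_injective (α := fun _ => W) v h
    ext j
    exact congrFun h' j
  · intro i hi
    obtain ⟨-, hi0, hie⟩ := Finset.mem_filter.1 hi
    have hinj : Function.Injective i := by
      rw [← Set.injOn_univ, ← Finset.coe_univ]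
      apply Finset.card_image_iff.1
      rw [hie, he, Finset.card_univ, Fintype.card_fin]
    have hmem : ∀ j : Fin n, i j.succ ∈ e.erase v := fun j => by
      rw [Finset.mem_erase]
      refine ⟨fun h => ?_, ?_⟩
      · rw [← hi0] at h
        exact Fin.succ_ne_zero j (hinj h)
      · rw [← hie]
        exact Finset.mem_image_of_mem _ (Finset.mem_univ _)
    refine ⟨Equiv.ofBijective (fun j => ⟨i j.succ, hmem j⟩) ?_, Finset.mem_univ _, ?_⟩
    · rw [Fintype.bijective_iff_injective_and_card]
      refine ⟨fun a b h => ?_, by rw [hcard, Fintype.card_fin]⟩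
      exact Fin.succ_injective _ (hinj (congrArg Subtype.val h))
    · funext j
      refine Fin.cases ?_ (fun j => ?_) j
      · rw [Fin.cons_zero, hi0]
      · rw [Fin.cons_succ]; rfl

/-- The `(k - 1)!` listings of an edge cancel the factor `1 / (k - 1)!` of the adjacency tensor. -/
lemma tensorApply_adjTensor [DecidableEq α] {k : ℕ} [NeZero k] {G : Hypergraph α} {V E}
    (h : IsModel G V E) (hu : G.IsUniform k) (z : α → ℝ) (v : G.vertexSet) :
    tensorApply (G.adjTensor k) (fun w => z w) v =
      ∑ e ∈ E with (v : α) ∈ e, ∏ w ∈ e.erase (v : α), z w := by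
  classical
  obtain ⟨n, rfl⟩ := Nat.exists_eq_succ_of_ne_zero (NeZero.ne k)
  have : Fintype G.vertexSet := by
    rw [h.vertexSet_eq]
    exact inferInstanceAs (Fintype (V : Set α))
  have hsub : ∀ e ∈ E, ∀ w ∈ e, w ∈ G.vertexSet := fun e he w hw =>
    subset_vertexSet_of_mem_edgeSet (h.coe_mem.2 he) hw
  unfold tensorApply
  have hset : {i : Fin (n + 1) → G.vertexSet | i 0 = v} =
      ((Finset.univ.filter fun i : Fin (n + 1) → G.vertexSet => i 0 = v : Finset _) : Set _) := by
    ext; simp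
  rw [hset, finsum_mem_coe_finset]
  -- Split the sum by the edge that the tuple lists.
  have hadj : ∀ i : Fin (n + 1) → G.vertexSet, G.adjTensor (n + 1) i =
      ∑ e ∈ E, if Finset.univ.image (fun j => (i j : α)) = e then 1 / (n.factorial : ℝ) else 0 := by
    intro i
    rw [Finset.sum_ite_eq]
    unfold adjTensor
    have : Set.range (fun j => (i j : α)) =
        ((Finset.univ.image (fun j => (i j : α)) : Finset α) : Set α) := by simp
    rw [this]
    simp only [h.coe_mem, Nat.succ_sub_one]
  simp_rw [hadj, Finset.sum_mul]
  rw [Finset.sum_comm, Finset.sum_filter]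
  refine Finset.sum_congr rfl fun e he => ?_
  have hcard : e.card = n + 1 := h.card hu e he
  simp_rw [ite_mul, zero_mul]
  rw [← Finset.sum_filter, Finset.filter_filter]
  split_ifs with hve
  · -- Transfer the edge to the vertex subtype to count the listings.
    let e' : Finset G.vertexSet := Finset.univ.filter fun w => (w : α) ∈ e
    have he'e : e'.image Subtype.val = e := by
      ext w
      simp only [e', Finset.mem_image, Finset.mem_filter, Finset.mem_univ, true_and]
      constructor
      · rintro ⟨w, hw, rfl⟩; exact hw
      · exact fun hw => ⟨⟨w, hsub e he w hw⟩, hw, rfl⟩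
    have hcard' : e'.card = n + 1 := by
      rw [← hcard, ← he'e, Finset.card_image_of_injective _ Subtype.val_injective]
    have himg : ∀ i : Fin (n + 1) → G.vertexSet,
        Finset.univ.image (fun j => (i j : α)) = e ↔ Finset.univ.image i = e' := by
      intro i
      rw [← (Finset.image_injective Subtype.val_injective).eq_iff, Finset.image_image, he'e]
      rfl
    have hprod : ∀ i ∈ Finset.univ.filter fun i : Fin (n + 1) → G.vertexSet =>
        i 0 = v ∧ Finset.univ.image (fun j => (i j : α)) = e,
        1 / (n.factorial : ℝ) * ∏ j ∈ Finset.univ.erase 0, z (i j) =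
          1 / (n.factorial : ℝ) * ∏ w ∈ e.erase (v : α), z w := by
      intro i hi
      obtain ⟨-, hi0, hie⟩ := Finset.mem_filter.1 hi
      have hinj : Set.InjOn (fun j => (i j : α)) (Finset.univ : Finset (Fin (n + 1))) := by
        apply Finset.card_image_iff.1
        rw [hie, hcard, Finset.card_univ, Fintype.card_fin]
      have : e.erase (v : α) = (Finset.univ.erase 0).image (fun j => (i j : α)) := by
        ext w
        simp only [Finset.mem_erase, Finset.mem_image, Finset.mem_univ, and_true]
        constructor
        · rintro ⟨hwv, hw⟩
          rw [← hie] at hw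
          obtain ⟨j, -, rfl⟩ := Finset.mem_image.1 hw
          refine ⟨j, ?_, rfl⟩
          rintro rfl
          exact hwv (by rw [hi0])
        · rintro ⟨j, hj, rfl⟩
          refine ⟨fun hw => hj (hinj (by simp) (by simp) ?_), ?_⟩
          · simp only [hw, hi0]
          · rw [← hie]
            exact Finset.mem_image_of_mem _ (Finset.mem_univ _)
      rw [this, Finset.prod_image (hinj.mono (by simp))]
    rw [Finset.sum_congr rfl hprod, Finset.sum_const]
    simp_rw [himg]
    have hve' : v ∈ e' := by simp [e', hve]
    rw [card_listings hcard' hve', nsmul_eq_mul, ← mul_assoc, mul_one_div_cancel, one_mul]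
    exact_mod_cast n.factorial_ne_zero
  · rw [Finset.filter_false_of_mem, Finset.sum_empty]
    rintro i - ⟨hi0, hie⟩
    apply hve
    rw [← hie, ← hi0]
    exact Finset.mem_image_of_mem _ (Finset.mem_univ _)

/-- For even `k` the least H-eigenvalue is the minimum of the Rayleigh quotient. -/
theorem leastHEigenvalue_spec {k : ℕ} [NeZero k] (hk : Even k) {G : Hypergraph α} {V E}
    (h : IsModel G V E) (hu : G.IsUniform k) (hne : G.vertexSet.Nonempty) :
    IsRayleighBound k V E (leastHEigenvalue k G) ∧
      ∃ x, (∃ v ∈ V, x v ≠ 0) ∧ AttainsRayleigh k V E (leastHEigenvalue k G) x := by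
  classical
  have hk0 : k ≠ 0 := NeZero.ne k
  have hneV : V.Nonempty := by rw [h.vertexSet_eq] at hne; exact_mod_cast hne
  obtain ⟨lam, hb, x, hx0, hx⟩ := exists_min_rayleigh hk hk0 h.subset (h.card hu) hneV
  have hmemV : ∀ v, v ∈ G.vertexSet ↔ v ∈ V := fun v => by rw [h.vertexSet_eq]; rfl
  suffices hlam : leastHEigenvalue k G = lam by rw [hlam]; exact ⟨hb, x, hx0, hx⟩
  refine IsLeast.csInf_eq ⟨?_, ?_⟩
  · obtain ⟨v₀, hv₀, hxv₀⟩ := hx0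
    refine ⟨fun w => x w, fun h0 => hxv₀ (congrFun h0 ⟨v₀, (hmemV _).2 hv₀⟩), fun v => ?_⟩
    rw [tensorApply_adjTensor h hu, hx.eigen hk0 hb ((hmemV _).1 v.2)]
  · rintro mu ⟨y, hy0, hy⟩
    let z : α → ℝ := fun v => if hv : v ∈ G.vertexSet then y ⟨v, hv⟩ else 0
    have hzy : (fun w : G.vertexSet => z w) = y := by
      funext w
      simp [z]
    -- Summing the eigenvalue equations shows that `mu` is a value of the Rayleigh quotient.
    have hz : ∀ v ∈ V, mu * z v ^ k = ∑ e ∈ E with v ∈ e, ∏ w ∈ e, z w := by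
      intro v hv
      have h1 := hy ⟨v, (hmemV v).2 hv⟩
      rw [← hzy, tensorApply_adjTensor h hu] at h1
      simp only at h1
      obtain ⟨n, rfl⟩ := Nat.exists_eq_succ_of_ne_zero hk0
      rw [Nat.succ_sub_one] at h1
      rw [pow_succ, ← mul_assoc, ← h1, Finset.sum_mul]
      exact Finset.sum_congr rfl fun e he => Finset.prod_erase_mul e _ (Finset.mem_filter.1 he).2
    have hsum : mu * ∑ v ∈ V, z v ^ k = k * edgeSum E z := by
      rw [Finset.mul_sum, Finset.sum_congr rfl hz]
      simp_rw [Finset.sum_filter]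
      rw [Finset.sum_comm, edgeSum, Finset.mul_sum]
      refine Finset.sum_congr rfl fun e he => ?_
      rw [← Finset.sum_filter, Finset.sum_const, nsmul_eq_mul, Finset.filter_mem_eq_inter,
        Finset.inter_eq_right.2 (h.subset e he), h.card hu e he]
    have hpos : 0 < ∑ v ∈ V, z v ^ k := by
      obtain ⟨w, hw⟩ := Function.ne_iff.1 hy0
      refine Finset.sum_pos' (fun v _ => hk.pow_nonneg _) ⟨w, (hmemV _).1 w.2, ?_⟩
      refine hk.pow_pos ?_
      have : z w = y w := congrFun hzy w
      rw [this]
      exact hw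
    have h1 := hb z
    rw [← hsum] at h1
    exact le_of_mul_le_mul_right h1 hpos

/-! ### Rooted hypertrees -/

/-- `(v, e)` is a walk `v₀ e₀ v₁ e₁ … v_n` of length `n` from `a` to `b` along edges in `F`. Values
of `v` beyond `n` and of `e` from `n` on are irrelevant. -/
structure IsWalk (F : Set (Set α)) (a b : α) (n : ℕ) (v : ℕ → α) (e : ℕ → Set α) : Prop where
  start : v 0 = a
  finish : v n = b
  step : ∀ i < n, e i ∈ F ∧ v i ∈ e i ∧ v (i + 1) ∈ e i

/-- Cutting out the part of a walk between positions `i` and `j`. -/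
lemma IsWalk.shortcut {F : Set (Set α)} {a b : α} {n : ℕ} {v : ℕ → α} {e : ℕ → Set α}
    (h : IsWalk F a b n v e) {i j : ℕ} (hij : i < j) (hjn : j ≤ n) (h1 : j < n → v i ∈ e j)
    (h2 : j = n → v i = v n) : ∃ m < n, ∃ v' e', IsWalk F a b m v' e' := by
  refine ⟨n - (j - i), by omega, fun t => if t ≤ i then v t else v (t + (j - i)),
    fun t => if t < i then e t else e (t + (j - i)), ?_, ?_, ?_⟩
  · simpa using h.start
  · split_ifs with ht
    · have hj : j = n := by omega
      have : n - (j - i) = i := by omega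
      rw [this, h2 hj, h.finish]
    · rw [show n - (j - i) + (j - i) = n by omega, h.finish]
  · intro t ht
    rcases lt_trichotomy t i with hti | rfl | hti
    · rw [if_pos hti, if_pos hti.le, if_pos (by omega)]
      exact h.step t (by omega)
    · have hj : j < n := by omega
      rw [if_neg (lt_irrefl _), if_pos le_rfl, if_neg (by omega),
        show t + 1 + (j - t) = j + 1 by omega, show t + (j - t) = j by omega]
      exact ⟨(h.step j hj).1, h1 hj, (h.step j hj).2.2⟩
    · rw [if_neg (by omega), if_neg (by omega), if_neg (by omega),
        show t + 1 + (j - i) = t + (j - i) + 1 by omega]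
      exact h.step _ (by omega)

lemma exists_isWalk {F : Set (Set α)} {a b : α}
    (h : Relation.ReflTransGen (fun x y => ∃ e ∈ F, x ∈ e ∧ y ∈ e) a b) :
    ∃ n v e, IsWalk F a b n v e := by
  induction h with
  | refl => exact ⟨0, fun _ => a, fun _ => ∅, rfl, rfl, fun i hi => absurd hi (Nat.not_lt_zero i)⟩
  | @tail b c _ hbc ih =>
    obtain ⟨n, v, e, hw⟩ := ih
    obtain ⟨f, hf, hb, hc⟩ := hbc
    refine ⟨n + 1, fun t => if t ≤ n then v t else c, fun t => if t < n then e t else f,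
      by simpa using hw.start, by simp, fun i hi => ?_⟩
    rcases (Nat.lt_succ_iff.1 hi).eq_or_lt with rfl | hi'
    · simp only [le_refl, if_true, lt_irrefl, if_false, Nat.not_succ_le_self]
      exact ⟨hf, hw.finish ▸ hb, hc⟩
    · rw [if_pos hi', if_pos hi'.le, if_pos (by omega)]
      exact hw.step i hi'

/-- In an acyclic hypergraph, an edge outside a set `F` of edges cannot contain two vertices that
are connected by `F`: a shortest walk between them would close up to a cycle. -/
lemma IsAcyclic.eq_of_reflTransGen {T : Hypergraph α} (hT : T.IsAcyclic) {F : Set (Set α)}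
    (hF : F ⊆ T.edgeSet) {f : Set α} (hf : f ∈ T.edgeSet) (hfF : f ∉ F) {a b : α} (ha : a ∈ f)
    (hb : b ∈ f) (hab : Relation.ReflTransGen (fun x y => ∃ e ∈ F, x ∈ e ∧ y ∈ e) a b) :
    a = b := by
  classical
  by_contra hne
  have hex := exists_isWalk hab
  obtain ⟨v, e, hw⟩ := Nat.find_spec hex
  have hmin : ∀ m < Nat.find hex, ¬ ∃ v e, IsWalk F a b m v e := fun m => Nat.find_min hex
  set n := Nat.find hex
  have hn : n ≠ 0 := by
    intro h0
    rw [h0] at hw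
    exact hne (hw.start.symm.trans hw.finish)
  have hcut : ∀ i j, i < j → j ≤ n → (j < n → v i ∈ e j) → (j = n → v i = v n) → False := by
    intro i j hij hjn h1 h2
    obtain ⟨m, hm, h⟩ := hw.shortcut hij hjn h1 h2
    exact hmin m hm h
  have hv : ∀ i j, i < j → j ≤ n → v i ≠ v j := fun i j hij hjn h =>
    hcut i j hij hjn (fun hj => h ▸ (hw.step j hj).2.1) (fun hj => hj ▸ h)
  have he : ∀ i j, i < j → j < n → e i ≠ e j := fun i j hij hjn h =>
    hcut i j hij hjn.le (fun _ => h ▸ (hw.step i (hij.trans hjn)).2.1) (fun hj => absurd hj hjn.ne)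
  have heF : ∀ i < n, e i ≠ f := fun i hi h => hfF (h ▸ (hw.step i hi).1)
  obtain ⟨n', hn'⟩ := Nat.exists_eq_succ_of_ne_zero hn
  refine hT ⟨n', fun i => v i, fun i => if (i : ℕ) < n then e i else f, ?_, ?_, ?_⟩
  · intro i j hij
    rcases lt_trichotomy (i : ℕ) j with h | h | h
    · exact absurd hij (hv _ _ h (by omega))
    · exact Fin.ext h
    · exact absurd hij.symm (hv _ _ h (by omega))
  · intro i j hij
    simp only at hij
    rcases lt_trichotomy (i : ℕ) j with h | h | h
    · rw [if_pos (by omega)] at hij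
      split_ifs at hij with h'
      · exact absurd hij (he _ _ h h')
      · exact absurd hij (heF _ (by omega))
    · exact Fin.ext h
    · rw [if_pos (show (j : ℕ) < n by omega)] at hij
      split_ifs at hij with h'
      · exact absurd hij.symm (he _ _ h h')
      · exact absurd hij.symm (heF _ (by omega))
  · intro i
    by_cases hi : (i : ℕ) < n
    · have : ((i + 1 : Fin (n' + 2)) : ℕ) = i + 1 := by
        rw [Fin.val_add_one, if_neg]
        intro h
        rw [h, Fin.val_last] at hi
        omega
      simp only [if_pos hi, this]
      exact ⟨hF (hw.step i hi).1, (hw.step i hi).2⟩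
    · have hin : (i : ℕ) = n := by omega
      have : i = Fin.last _ := Fin.ext (by rw [Fin.val_last]; omega)
      have h0 : i + 1 = 0 := by rw [this, Fin.last_add_one]
      simp only [h0, Fin.val_zero, hw.start, hin, hw.finish, lt_irrefl, if_false]
      exact ⟨hf, hb, ha⟩

/-- `p` chooses in each edge `e ∈ E` a vertex, its parent, such that the remaining vertices of the
edges, their children, partition `U`. -/
structure IsParentMap (E : Set (Set α)) (U : Set α) (p : Set α → α) : Prop where
  mem : ∀ e ∈ E, p e ∈ e
  disjoint : ∀ e ∈ E, ∀ f ∈ E, e ≠ f → Disjoint (e \ {p e}) (f \ {p f})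
  cover : ∀ v, v ∈ U ↔ ∃ e ∈ E, v ∈ e \ {p e}

/-- A hypertree can be rooted at any vertex `r`: the parent map is built by growing a subtree from
`r` edge by edge, where acyclicity means that a new edge meets the subtree in one vertex only. -/
theorem IsHypertree.exists_isParentMap {k : ℕ} (hk : k ≠ 0) {T : Hypergraph α}
    (hT : T.IsHypertree k) {r : α} (hr : r ∈ T.vertexSet) :
    ∃ p, IsParentMap T.edgeSet (T.vertexSet \ {r}) p := by
  classical
  let P : Set (Set α) → Prop := fun F => ∃ U p, IsParentMap F (U \ {r}) p ∧ r ∈ U ∧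
    U ⊆ T.vertexSet ∧ (∀ e ∈ F, e ⊆ U) ∧
    ∀ u ∈ U, Relation.ReflTransGen (fun x y => ∃ e ∈ F, x ∈ e ∧ y ∈ e) r u
  have hfin : T.edgeSet.Finite :=
    hT.finite.finite_subsets.subset fun e he => subset_vertexSet_of_mem_edgeSet he
  have hP0 : P ∅ := by
    refine ⟨{r}, fun _ => r, ⟨by simp, by simp, by simp⟩, rfl, by simpa using hr, by simp, ?_⟩
    rintro u rfl
    exact Relation.ReflTransGen.refl
  have hfin' : {F | F ⊆ T.edgeSet ∧ P F}.Finite := hfin.finite_subsets.subset fun F hF => hF.1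
  obtain ⟨F, ⟨hFT, U, p, hp, hrU, hUV, hFU, hconn⟩, hmax⟩ :=
    hfin'.exists_maximal ⟨∅, Set.empty_subset _, hP0⟩
  -- If no unused edge meets `U`, then `U` is closed under adjacency.
  have hclosed : (∀ f ∈ T.edgeSet, f ∉ F → ∀ a ∈ f, a ∉ U) → T.vertexSet ⊆ U := by
    intro h v hv
    have h1 := hT.connected.2 r hr v hv
    induction h1 with
    | refl => exact hrU
    | tail _ hbc ih =>
      obtain ⟨f, hf, hb, hc⟩ := hbc
      have hbU := ih (mem_vertexSet_of_mem_edgeSet hf hb)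
      by_cases hfF : f ∈ F
      · exact hFU f hfF hc
      · exact absurd hbU (h f hf hfF _ hb)
  have hall : ∀ f ∈ T.edgeSet, f ∉ F → ∀ a ∈ f, a ∉ U := by
    intro f hf hfF a haf haU
    have hsymm : Std.Symm (fun x y => ∃ e ∈ F, x ∈ e ∧ y ∈ e) :=
      ⟨fun x y ⟨e, he, hx, hy⟩ => ⟨e, he, hy, hx⟩⟩
    have huniq : ∀ b ∈ f, b ∈ U → b = a := fun b hbf hbU =>
      hT.acyclic.eq_of_reflTransGen hFT hf hfF hbf haf
        ((Relation.ReflTransGen.stdSymm.symm _ _ (hconn b hbU)).trans (hconn a haU))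
    have hmono : ∀ u, Relation.ReflTransGen (fun x y => ∃ e ∈ F, x ∈ e ∧ y ∈ e) r u →
        Relation.ReflTransGen (fun x y => ∃ e ∈ insert f F, x ∈ e ∧ y ∈ e) r u := fun u h =>
      Relation.ReflTransGen.mono
        (fun x y ⟨e, he, hxy⟩ => ⟨e, Set.mem_insert_of_mem _ he, hxy⟩) _ _ h
    have hp' : ∀ e ∈ F, Function.update p f a e = p e := fun e he =>
      Function.update_of_ne (ne_of_mem_of_not_mem he hfF) _ _
    have hdisj : ∀ e ∈ F, Disjoint (f \ {a}) (e \ {p e}) := fun e he =>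
      Set.disjoint_left.2 fun x hx hxe => hx.2 (huniq x hx.1 (hFU e he hxe.1))
    have hPF : P (insert f F) := by
      refine ⟨U ∪ f, Function.update p f a, ⟨?_, ?_, ?_⟩, Or.inl hrU,
        Set.union_subset hUV (subset_vertexSet_of_mem_edgeSet hf), ?_, ?_⟩
      · rintro e (rfl | he)
        · rwa [Function.update_self]
        · rw [hp' e he]; exact hp.mem e he
      · rintro e (rfl | he) e' (rfl | he') hne
        · exact absurd rfl hne
        · rw [Function.update_self, hp' e' he']; exact hdisj e' he'
        · rw [Function.update_self, hp' e he]; exact (hdisj e he).symm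
        · rw [hp' e he, hp' e' he']; exact hp.disjoint e he e' he' hne
      · intro v
        constructor
        · rintro ⟨hv, hvr⟩
          by_cases hvU : v ∈ U
          · obtain ⟨e, he, hve⟩ := (hp.cover v).1 ⟨hvU, hvr⟩
            exact ⟨e, Or.inr he, by rwa [hp' e he]⟩
          · refine ⟨f, Or.inl rfl, hv.resolve_left hvU, ?_⟩
            rw [Function.update_self]
            rintro rfl
            exact hvU haU
        · rintro ⟨e, rfl | he, hve⟩
          · rw [Function.update_self] at hve
            refine ⟨Or.inr hve.1, ?_⟩
            rintro rfl
            exact hve.2 (huniq _ hve.1 hrU)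
          · rw [hp' e he] at hve
            have := (hp.cover v).2 ⟨e, he, hve⟩
            exact ⟨Or.inl this.1, this.2⟩
      · rintro e (rfl | he)
        · exact Set.subset_union_right
        · exact (hFU e he).trans Set.subset_union_left
      · rintro u (hu | hu)
        · exact hmono u (hconn u hu)
        · exact (hmono a (hconn a haU)).tail ⟨f, Set.mem_insert _ _, haf, hu⟩
    exact hfF (hmax ⟨Set.insert_subset hf hFT, hPF⟩ (Set.subset_insert f F) (Set.mem_insert f F))
  have hVU : U = T.vertexSet := hUV.antisymm (hclosed hall)
  have hFE : F = T.edgeSet := by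
    refine hFT.antisymm fun f hf => ?_
    by_contra hfF
    obtain ⟨a, ha⟩ : f.Nonempty := by
      refine Set.nonempty_of_ncard_ne_zero ?_
      rw [hT.uniform f hf]
      exact hk
    exact hall f hf hfF a ha (hVU ▸ mem_vertexSet_of_mem_edgeSet hf ha)
  exact ⟨p, by rw [← hFE, ← hVU]; exact hp⟩

lemma IsHyperstar.isHypertree {k m : ℕ} {c : α} {S : Hypergraph α} (hS : IsHyperstar k m c S) :
    S.IsHypertree k where
  finite := hS.finite
  uniform := hS.uniform
  connected := by
    have hcv : ∀ v ∈ S.vertexSet, v = c ∨ S.Adj c v := by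
      intro v hv
      rw [hS.vertexSet_eq] at hv
      rcases hv with rfl | ⟨e, he, hve⟩
      · exact Or.inl rfl
      · exact Or.inr ⟨e, he, hS.center_mem e he, hve⟩
    refine ⟨⟨c, by rw [hS.vertexSet_eq]; exact Set.mem_insert _ _⟩, fun x hx y hy => ?_⟩
    have h1 : Relation.ReflTransGen S.Adj x c := by
      rcases hcv x hx with rfl | h
      · exact Relation.ReflTransGen.refl
      · exact Relation.ReflTransGen.single h.symm
    rcases hcv y hy with rfl | h
    · exact h1
    · exact h1.tail h
  acyclic := by
    rintro ⟨n, v, e, hv, he, h⟩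
    -- Consecutive edges of a cycle in a star meet in the center only.
    have hc : ∀ i, v (i + 1) = c := by
      intro i
      have hne : e i ≠ e (i + 1) := fun heq => by
        have h1 : i = i + 1 := he heq
        simp at h1
      have : v (i + 1) ∈ e i ∩ e (i + 1) := ⟨(h i).2.2, (h (i + 1)).2.1⟩
      rwa [hS.inter_eq _ (h i).1 _ (h (i + 1)).1 hne] at this
    have h1 : (0 : Fin (n + 2)) + 1 = 1 + 1 := hv ((hc 0).trans (hc 1).symm)
    simp at h1

lemma not_subset_singleton {k : ℕ} (hk : 2 ≤ k) {e : Set α} (he : e.ncard = k) (a : α) :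
    ¬ e ⊆ {a} := by
  intro hsub
  have := Set.ncard_le_ncard hsub
  rw [Set.ncard_singleton, he] at this
  omega

/-- The trees attached to `G₀` can be rooted simultaneously, each one at its vertex in `G₀`, except
that the tree containing a prescribed vertex `q` outside `G₀` is rooted at `q`. Then `c` is the
vertex of `G₀` where this tree is attached. -/
theorem IsTreeAttachment.exists_isParentMap {k : ℕ} (hk : 2 ≤ k) {G₀ G : Hypergraph α}
    (h : IsTreeAttachment k G₀ G) {q : α} (hq : q ∈ G.vertexSet) :
    ∃ c ∈ G₀.vertexSet, (q ∈ G₀.vertexSet → c = q) ∧ ∃ E₁ p,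
      G.edgeSet = G₀.edgeSet ∪ E₁ ∧ (∀ e ∈ E₁, e.ncard = k) ∧
      (∀ e ∈ E₁, ¬ e ⊆ G₀.vertexSet) ∧
      IsParentMap E₁ (G.vertexSet \ insert q (G₀.vertexSet \ {c})) p := by
  classical
  obtain ⟨n, T, r, hT, hG₀T, hTT, hV, hE⟩ := h
  have hk0 : k ≠ 0 := by omega
  have hr0 : ∀ i, r i ∈ G₀.vertexSet := fun i => by
    have : r i ∈ G₀.vertexSet ∩ (T i).vertexSet := by rw [hG₀T]; rfl
    exact this.1
  have hrT : ∀ i, r i ∈ (T i).vertexSet := fun i => by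
    have : r i ∈ G₀.vertexSet ∩ (T i).vertexSet := by rw [hG₀T]; rfl
    exact this.2
  have hr_eq : ∀ i v, v ∈ G₀.vertexSet → v ∈ (T i).vertexSet → v = r i := fun i v h0 h1 => by
    have : v ∈ G₀.vertexSet ∩ (T i).vertexSet := ⟨h0, h1⟩
    rwa [hG₀T] at this
  have hcard : ∀ e ∈ ⋃ i, (T i).edgeSet, e.ncard = k := by
    intro e he
    obtain ⟨i, hi⟩ := Set.mem_iUnion.1 he
    exact (hT i).uniform e hi
  have hout : ∀ e ∈ ⋃ i, (T i).edgeSet, ¬ e ⊆ G₀.vertexSet := by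
    intro e he hsub
    obtain ⟨i, hi⟩ := Set.mem_iUnion.1 he
    exact not_subset_singleton hk (hcard e he) (r i) fun v hv =>
      hr_eq i v (hsub hv) (mem_vertexSet_of_mem_edgeSet hi hv)
  -- The root `s i` of the tree `T i`.
  obtain ⟨c, hc, hcq, s, hs, hsc⟩ : ∃ c ∈ G₀.vertexSet, (q ∈ G₀.vertexSet → c = q) ∧
      ∃ s : Fin n → α, (∀ i, s i ∈ (T i).vertexSet) ∧
        ∀ i, (s i = r i ∧ (q ∉ G₀.vertexSet → q ∉ (T i).vertexSet)) ∨
          (s i = q ∧ r i = c ∧ q ∉ G₀.vertexSet ∧ ∀ j ≠ i, s j = r j) := by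
    by_cases hq0 : q ∈ G₀.vertexSet
    · exact ⟨q, hq0, fun _ => rfl, r, hrT, fun i => Or.inl ⟨rfl, fun h => absurd hq0 h⟩⟩
    · have hq' := hq
      rw [hV] at hq'
      obtain ⟨j, hj⟩ := Set.mem_iUnion.1 (hq'.resolve_left hq0)
      refine ⟨r j, hr0 j, fun h => absurd h hq0, Function.update r j q, fun i => ?_, fun i => ?_⟩
      · by_cases hij : i = j
        · subst hij; rwa [Function.update_self]
        · rw [Function.update_of_ne hij]; exact hrT i
      · by_cases hij : i = j
        · subst hij
          exact Or.inr ⟨Function.update_self _ _ _, rfl, hq0,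
            fun l hl => Function.update_of_ne hl _ _⟩
        · refine Or.inl ⟨Function.update_of_ne hij _ _, fun _ hqi => hq0 ?_⟩
          have := (hTT i j hij ⟨hqi, hj⟩).1
          rw [Set.mem_singleton_iff] at this
          rw [this]
          exact hr0 i
  choose P hP using fun i => (hT i).exists_isParentMap hk0 (hs i)
  let idx : Set α → Option (Fin n) := fun e =>
    if h : ∃ i, e ∈ (T i).edgeSet then some h.choose else none
  have hidx : ∀ i, ∀ e ∈ (T i).edgeSet, idx e = some i := by
    intro i e he
    have hex : ∃ i, e ∈ (T i).edgeSet := ⟨i, he⟩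
    simp only [idx, dif_pos hex, Option.some.injEq]
    by_contra hne
    refine not_subset_singleton hk ((hT i).uniform e he) (r i) fun v hv => ?_
    exact (hTT i _ (Ne.symm hne) ⟨mem_vertexSet_of_mem_edgeSet he hv,
      mem_vertexSet_of_mem_edgeSet hex.choose_spec hv⟩).1
  let p : Set α → α := fun e => (idx e).elim c fun i => P i e
  have hp : ∀ i, ∀ e ∈ (T i).edgeSet, p e = P i e := fun i e he => by
    simp only [p, hidx i e he, Option.elim]
  refine ⟨c, hc, hcq, ⋃ i, (T i).edgeSet, p, hE, hcard, hout, ?_, ?_, ?_⟩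
  · intro e he
    obtain ⟨i, hi⟩ := Set.mem_iUnion.1 he
    rw [hp i e hi]
    exact (hP i).mem e hi
  · intro e he f hf hef
    obtain ⟨i, hi⟩ := Set.mem_iUnion.1 he
    obtain ⟨j, hj⟩ := Set.mem_iUnion.1 hf
    rw [hp i e hi, hp j f hj]
    by_cases hij : i = j
    · subst hij
      exact (hP i).disjoint e hi f hj hef
    · rw [Set.disjoint_left]
      intro v hve hvf
      have hv := hTT i j hij ⟨mem_vertexSet_of_mem_edgeSet hi hve.1,
        mem_vertexSet_of_mem_edgeSet hj hvf.1⟩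
      have hvi : v = r i := hv.1
      have hvj : v = r j := hv.2
      have h1 := ((hP i).cover v).2 ⟨e, hi, hve⟩
      have h2 := ((hP j).cover v).2 ⟨f, hj, hvf⟩
      rcases hsc i with h | h
      · exact h1.2 (hvi.trans h.1.symm)
      · exact h2.2 (hvj.trans (h.2.2.2 j (Ne.symm hij)).symm)
  · intro v
    have hcov : (∃ e ∈ ⋃ i, (T i).edgeSet, v ∈ e \ {p e}) ↔
        ∃ i, v ∈ (T i).vertexSet ∧ v ≠ s i := by
      constructor
      · rintro ⟨e, he, hv⟩
        obtain ⟨i, hi⟩ := Set.mem_iUnion.1 he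
        rw [hp i e hi] at hv
        exact ⟨i, ((hP i).cover v).2 ⟨e, hi, hv⟩⟩
      · rintro ⟨i, hv⟩
        obtain ⟨e, he, hve⟩ := ((hP i).cover v).1 hv
        exact ⟨e, Set.mem_iUnion.2 ⟨i, he⟩, by rwa [hp i e he]⟩
    rw [hcov, hV]
    constructor
    · rintro ⟨hv, hvn⟩
      rw [Set.mem_insert_iff, not_or] at hvn
      by_cases hv0 : v ∈ G₀.vertexSet
      · have hvc : v = c := by
          by_contra hne
          exact hvn.2 ⟨hv0, hne⟩
        have hq0 : q ∉ G₀.vertexSet := fun hq0 => hvn.1 (hvc.trans (hcq hq0))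
        -- Here `v = c`, which is not the root of the tree that contains `q`.
        rw [hV] at hq
        obtain ⟨j, hj⟩ := Set.mem_iUnion.1 (hq.resolve_left hq0)
        rcases hsc j with h | h
        · exact absurd hj (h.2 hq0)
        · exact ⟨j, by rw [hvc, ← h.2.1]; exact hrT j, by rw [h.1]; exact hvn.1⟩
      · obtain ⟨i, hi⟩ := Set.mem_iUnion.1 (hv.resolve_left hv0)
        refine ⟨i, hi, ?_⟩
        rcases hsc i with h | h
        · rw [h.1]; rintro rfl; exact hv0 (hr0 i)
        · rw [h.1]; exact hvn.1
    · rintro ⟨i, hvi, hvs⟩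
      refine ⟨Or.inr (Set.mem_iUnion.2 ⟨i, hvi⟩), ?_⟩
      rcases hsc i with h | h
      · rw [h.1] at hvs
        have hv0 : v ∉ G₀.vertexSet := fun h0 => hvs (hr_eq i v h0 hvi)
        rintro (rfl | hv)
        · exact h.2 hv0 hvi
        · exact hv0 hv.1
      · rw [h.1] at hvs
        rintro (hv | ⟨hv, hvc⟩)
        · exact hvs hv
        · exact hvc ((hr_eq i v hv hvi).trans h.2.1)

/-! ### Comparison with a star -/

section Star

variable [DecidableEq α] {k : ℕ} {V V₀ : Finset α} {E₀ E₁ : Finset (Finset α)}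
  {p : Finset α → α} {c q : α}

/-- A hypergraph with vertex set `V` and edge set `E₀ ∪ E₁`, where `E₀` are the edges of a
hypergraph on `V₀ ⊆ V` and `E₁` those of the attached trees, together with a parent map `p` on `E₁`.
One tree, attached at `c ∈ V₀`, is rooted at `q`, either because `q = c` or because it contains
`q ∉ V₀`; the others are rooted in `V₀`. -/
structure IsRootedAttachment (k : ℕ) (V V₀ : Finset α) (E₀ E₁ : Finset (Finset α))
    (p : Finset α → α) (c q : α) : Prop where
  two_le : 2 ≤ k
  subset : V₀ ⊆ V
  edge_subset : ∀ e ∈ E₀, e ⊆ V₀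
  card_edge : ∀ e ∈ E₀, e.card = k
  branch_subset : ∀ e ∈ E₁, e ⊆ V
  card_branch : ∀ e ∈ E₁, e.card = k
  branch_not_subset : ∀ e ∈ E₁, ¬ e ⊆ V₀
  center_mem : c ∈ V₀
  root_mem : q ∈ V
  root_eq : q ∈ V₀ → c = q
  parent_mem : ∀ e ∈ E₁, p e ∈ e
  disjoint : ∀ e ∈ E₁, ∀ f ∈ E₁, e ≠ f → Disjoint (e.erase (p e)) (f.erase (p f))
  cover : ∀ v, (v ∈ V ∧ v ∉ insert q (V₀.erase c)) ↔ ∃ e ∈ E₁, v ∈ e.erase (p e)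

/-- The leaves of the edge that replaces `e` in the star at `c`: the children of `e`, after `c` and
`q` have exchanged their places. -/
def leaves (p : Finset α → α) (c q : α) (e : Finset α) : Finset α :=
  (e.erase (p e)).image (Equiv.swap c q)

/-- The edges of the hypergraph in which the trees are replaced by a star at `c`. -/
def starEdges (E₀ E₁ : Finset (Finset α)) (p : Finset α → α) (c q : α) : Finset (Finset α) :=
  E₀ ∪ E₁.image fun e => insert c (leaves p c q e)

namespace IsRootedAttachment

variable (h : IsRootedAttachment k V V₀ E₀ E₁ p c q)
include h

lemma disjoint_edges : Disjoint E₀ E₁ :=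
  Finset.disjoint_left.2 fun e he he' => h.branch_not_subset e he' (h.edge_subset e he)

lemma root_eq_or : c = q ∨ q ∉ V₀ := (em (q ∈ V₀)).imp_left h.root_eq

lemma swap_mem {v : α} (hv : v ∈ V) : Equiv.swap c q v ∈ V := by
  by_cases h1 : v = c
  · rw [h1, Equiv.swap_apply_left]; exact h.root_mem
  · by_cases h2 : v = q
    · rw [h2, Equiv.swap_apply_right]; exact h.subset h.center_mem
    · rwa [Equiv.swap_apply_of_ne_of_ne h1 h2]

lemma mem_leaves_iff {v : α} : (v ∈ V ∧ v ∉ V₀) ↔ ∃ e ∈ E₁, v ∈ leaves p c q e := by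
  have h1 : (v ∈ V ∧ v ∉ V₀) ↔
      (Equiv.swap c q v ∈ V ∧ Equiv.swap c q v ∉ insert q (V₀.erase c)) := by
    have hc := h.center_mem
    have hcV := h.subset hc
    have hq := h.root_mem
    by_cases hvc : v = c
    · subst hvc
      simp [hc]
    · by_cases hvq : v = q
      · subst hvq
        have : v ∉ V₀ := fun hv => hvc (h.root_eq hv).symm
        simp [hcV, hq, this, Ne.symm hvc]
      · rw [Equiv.swap_apply_of_ne_of_ne hvc hvq]
        simp [hvc, hvq]
  rw [h1, h.cover]
  refine exists_congr fun e => and_congr_right fun _ => ?_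
  rw [leaves, Finset.mem_image]
  constructor
  · exact fun hv => ⟨_, hv, Equiv.swap_apply_self _ _ _⟩
  · rintro ⟨w, hw, rfl⟩
    rwa [Equiv.swap_apply_self]

lemma leaves_notMem {e : Finset α} (he : e ∈ E₁) {v : α} (hv : v ∈ leaves p c q e) : v ∉ V₀ :=
  (h.mem_leaves_iff.2 ⟨e, he, hv⟩).2

lemma center_notMem_leaves {e : Finset α} (he : e ∈ E₁) : c ∉ leaves p c q e := fun hc =>
  h.leaves_notMem he hc h.center_mem

lemma disjoint_leaves {e f : Finset α} (he : e ∈ E₁) (hf : f ∈ E₁) (hef : e ≠ f) :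
    Disjoint (leaves p c q e) (leaves p c q f) :=
  (Finset.disjoint_image (Equiv.injective _)).2 (h.disjoint e he f hf hef)

lemma card_leaves {e : Finset α} (he : e ∈ E₁) : (leaves p c q e).card = k - 1 := by
  rw [leaves, Finset.card_image_of_injective _ (Equiv.injective _),
    Finset.card_erase_of_mem (h.parent_mem e he), h.card_branch e he]

lemma leaves_nonempty {e : Finset α} (he : e ∈ E₁) : (leaves p c q e).Nonempty := by
  have := h.two_le
  exact Finset.card_pos.1 (by rw [h.card_leaves he]; omega)

lemma card_starEdge {e : Finset α} (he : e ∈ E₁) : (insert c (leaves p c q e)).card = k := by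
  have := h.two_le
  rw [Finset.card_insert_of_notMem (h.center_notMem_leaves he), h.card_leaves he]
  omega

lemma starEdge_inj {e f : Finset α} (he : e ∈ E₁) (hf : f ∈ E₁)
    (hef : insert c (leaves p c q e) = insert c (leaves p c q f)) : e = f := by
  by_contra hne
  obtain ⟨v, hv⟩ := h.leaves_nonempty he
  have hv' : v ∈ insert c (leaves p c q f) := hef ▸ Finset.mem_insert_of_mem hv
  rcases Finset.mem_insert.1 hv' with rfl | hvf
  · exact h.center_notMem_leaves he hv
  · exact Finset.disjoint_left.1 (h.disjoint_leaves he hf hne) hv hvf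

lemma starEdge_notMem {e : Finset α} (he : e ∈ E₁) : insert c (leaves p c q e) ∉ E₀ := by
  intro hmem
  obtain ⟨v, hv⟩ := h.leaves_nonempty he
  exact h.leaves_notMem he hv (h.edge_subset _ hmem (Finset.mem_insert_of_mem hv))

lemma disjoint_starEdges : Disjoint E₀ (E₁.image fun e => insert c (leaves p c q e)) := by
  rw [Finset.disjoint_right]
  intro f hf
  obtain ⟨e, he, rfl⟩ := Finset.mem_image.1 hf
  exact h.starEdge_notMem he

lemma starEdges_subset : ∀ e ∈ starEdges E₀ E₁ p c q, e ⊆ V := by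
  intro e he
  rcases Finset.mem_union.1 he with he | he
  · exact (h.edge_subset e he).trans h.subset
  · obtain ⟨f, hf, rfl⟩ := Finset.mem_image.1 he
    intro v hv
    rcases Finset.mem_insert.1 hv with rfl | hv
    · exact h.subset h.center_mem
    · exact (h.mem_leaves_iff.2 ⟨f, hf, hv⟩).1

lemma card_starEdges : ∀ e ∈ starEdges E₀ E₁ p c q, e.card = k := by
  intro e he
  rcases Finset.mem_union.1 he with he | he
  · exact h.card_edge e he
  · obtain ⟨f, hf, rfl⟩ := Finset.mem_image.1 he
    exact h.card_starEdge hf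

/-- Sums over the edges of the star hypergraph that satisfy `P`. -/
lemma sum_starEdges (P : Finset α → Prop) [DecidablePred P] (g : Finset α → ℝ) :
    ∑ f ∈ starEdges E₀ E₁ p c q with P f, g f = ∑ f ∈ E₀ with P f, g f +
      ∑ e ∈ E₁ with P (insert c (leaves p c q e)), g (insert c (leaves p c q e)) := by
  rw [starEdges, Finset.filter_union, Finset.sum_union
    (Finset.disjoint_filter_filter h.disjoint_starEdges), Finset.filter_image, Finset.sum_image]
  intro e he f hf hef
  exact h.starEdge_inj (Finset.mem_filter.1 he).1 (Finset.mem_filter.1 hf).1 hef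

/-- Signs outside `V₀` can be chosen such that the product over each edge of the star is
nonpositive. -/
lemma exists_signs (z : α → ℝ) : ∃ y : α → ℝ, (∀ v, |y v| = |z v|) ∧ (∀ v ∈ V₀, y v = z v) ∧
    ∀ e ∈ E₁, ∏ v ∈ insert c (leaves p c q e), y v =
      -(|z c| * ∏ v ∈ leaves p c q e, |z v|) := by
  classical
  have hex : ∀ e : Finset α, ∃ w, e ∈ E₁ → w ∈ leaves p c q e := fun e => by
    by_cases he : e ∈ E₁
    · obtain ⟨w, hw⟩ := h.leaves_nonempty he
      exact ⟨w, fun _ => hw⟩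
    · exact ⟨c, fun h => absurd h he⟩
  choose w hw using hex
  obtain ⟨s, hs, hs'⟩ : ∃ s : ℝ, |s| = 1 ∧ z c * s = -|z c| := by
    rcases le_total 0 (z c) with h | h
    · exact ⟨-1, by simp, by rw [abs_of_nonneg h]; ring⟩
    · exact ⟨1, by simp, by rw [abs_of_nonpos h]; ring⟩
  let y : α → ℝ := fun v => if v ∈ V₀ then z v else if ∃ e ∈ E₁, v = w e then s * |z v| else |z v|
  refine ⟨y, fun v => ?_, fun v hv => if_pos hv, fun e he => ?_⟩
  · simp only [y]
    split_ifs
    · rfl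
    · rw [abs_mul, hs, one_mul, abs_abs]
    · rw [abs_abs]
  · rw [Finset.prod_insert (h.center_notMem_leaves he), ← Finset.mul_prod_erase _ _ (hw e he),
      ← Finset.mul_prod_erase _ (fun v => |z v|) (hw e he)]
    have h1 : y c = z c := if_pos h.center_mem
    have h2 : y (w e) = s * |z (w e)| := by
      simp only [y]
      rw [if_neg (h.leaves_notMem he (hw e he)), if_pos ⟨e, he, rfl⟩]
    have h3 : ∏ v ∈ (leaves p c q e).erase (w e), y v =
        ∏ v ∈ (leaves p c q e).erase (w e), |z v| := by
      refine Finset.prod_congr rfl fun v hv => ?_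
      have hve := Finset.mem_of_mem_erase hv
      simp only [y]
      rw [if_neg (h.leaves_notMem he hve), if_neg]
      rintro ⟨f, hf, rfl⟩
      have hne : f ≠ e := by
        rintro rfl
        exact Finset.ne_of_mem_erase hv rfl
      exact Finset.disjoint_left.1 (h.disjoint_leaves hf he hne) (hw f hf) hve
    rw [h1, h2, h3]
    linear_combination (|z (w e)| * ∏ v ∈ (leaves p c q e).erase (w e), |z v|) * hs'

end IsRootedAttachment

/-- The partial derivative at `c` of the edge polynomial of `E`. -/
def edgeDeriv (E : Finset (Finset α)) (x : α → ℝ) (c : α) : ℝ :=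
  ∑ e ∈ E with c ∈ e, ∏ w ∈ e.erase c, x w

lemma mul_edgeDeriv (E : Finset (Finset α)) (x : α → ℝ) (c : α) :
    x c * edgeDeriv E x c = ∑ e ∈ E with c ∈ e, ∏ w ∈ e, x w := by
  rw [edgeDeriv, Finset.mul_sum]
  exact Finset.sum_congr rfl fun e he => Finset.mul_prod_erase e _ (Finset.mem_filter.1 he).2

namespace IsRootedAttachment

variable {lam lamH : ℝ} {x : α → ℝ}

/-- The comparison of the Rayleigh quotients, and its case of equality. If `|x q|` is the maximum of
`|x|`, then exchanging the values at `c` and `q` and adjusting signs turns a minimizer `x` of `G`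
into a vector `y` on the star hypergraph for which the contribution of each tree edge, and that of
`E₀`, does not increase. If the least eigenvalue does not drop, all these are equalities. -/
theorem exists_star_vector (h : IsRootedAttachment k V V₀ E₀ E₁ p c q) (hk : Even k)
    (hx : AttainsRayleigh k V (E₀ ∪ E₁) lam x) (hxq : x q ≠ 0) (hmax : ∀ v ∈ V, |x v| ≤ |x q|)
    (hbH : IsRayleighBound k V (starEdges E₀ E₁ p c q) lamH) (hle : lam ≤ lamH) :
    lamH = lam ∧ ∃ y : α → ℝ, AttainsRayleigh k V (starEdges E₀ E₁ p c q) lam y ∧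
      |y c| = |x q| ∧ (∀ v ∈ V₀, v ≠ c → y v = x v) ∧
      x c * edgeDeriv E₀ x c = y c * edgeDeriv E₀ x c ∧
      x c * edgeDeriv E₀ x c = -(|edgeDeriv E₀ x c| * |x q|) ∧
      ∀ e ∈ E₁, ∏ v ∈ e, x v = -(|x q| * ∏ v ∈ e.erase (p e), |x v|) ∧
        ∏ v ∈ insert c (leaves p c q e), y v = ∏ v ∈ e, x v := by
  have hk2 := h.two_le
  set a := edgeDeriv E₀ x c with ha
  obtain ⟨s, hs, hs'⟩ : ∃ s : ℝ, |s| = 1 ∧ s * a = -|a| := by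
    rcases le_total 0 a with h | h
    · exact ⟨-1, by simp, by rw [abs_of_nonneg h]; ring⟩
    · exact ⟨1, by simp, by rw [abs_of_nonpos h]; ring⟩
  let z : α → ℝ := fun v => if v = c then s * |x q| else x (Equiv.swap c q v)
  have hz_abs : ∀ v, |z v| = |x (Equiv.swap c q v)| := by
    intro v
    simp only [z]
    split_ifs with hv
    · rw [hv, Equiv.swap_apply_left, abs_mul, hs, one_mul, abs_abs]
    · rfl
  have hzc : z c = s * |x q| := if_pos rfl
  obtain ⟨y, hy_abs, hy0, hy1⟩ := h.exists_signs z
  have hyc : y c = s * |x q| := (hy0 c h.center_mem).trans hzc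
  have hycq : |y c| = |x q| := by rw [hyc, abs_mul, hs, one_mul, abs_abs]
  have hyV₀ : ∀ v ∈ V₀, v ≠ c → y v = x v := by
    intro v hv hvc
    rw [hy0 v hv]
    simp only [z, if_neg hvc]
    rw [Equiv.swap_apply_of_ne_of_ne hvc]
    rintro rfl
    exact hvc (h.root_eq hv).symm
  have hnorm : ∑ v ∈ V, y v ^ k = ∑ v ∈ V, x v ^ k := by
    refine Finset.sum_bij' (fun v _ => Equiv.swap c q v) (fun v _ => Equiv.swap c q v)
      (fun v hv => h.swap_mem hv) (fun v hv => h.swap_mem hv)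
      (fun v _ => Equiv.swap_apply_self _ _ _) (fun v _ => Equiv.swap_apply_self _ _ _) ?_
    intro v _
    rw [← hk.pow_abs, hy_abs, hz_abs, hk.pow_abs]
  have hpos : 0 < ∑ v ∈ V, x v ^ k :=
    Finset.sum_pos' (fun v _ => hk.pow_nonneg _) ⟨q, h.root_mem, hk.pow_pos hxq⟩
  -- Contributions of the tree edges.
  have hstar : ∀ e ∈ E₁, ∏ v ∈ insert c (leaves p c q e), y v =
      -(|x q| * ∏ v ∈ e.erase (p e), |x v|) := by
    intro e he
    rw [hy1 e he, hzc, abs_mul, hs, one_mul, abs_abs, leaves,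
      Finset.prod_image (Equiv.injective _).injOn]
    simp only [hz_abs, Equiv.swap_apply_self]
  have hterm : ∀ e ∈ E₁, -(|x q| * ∏ v ∈ e.erase (p e), |x v|) ≤ ∏ v ∈ e, x v := by
    intro e he
    refine neg_le.1 ((neg_le_abs _).trans ?_)
    rw [Finset.abs_prod, ← Finset.mul_prod_erase e _ (h.parent_mem e he)]
    exact mul_le_mul_of_nonneg_right (hmax _ (h.branch_subset e he (h.parent_mem e he)))
      (Finset.prod_nonneg fun _ _ => abs_nonneg _)
  -- Contributions of `E₀`, affine in the value at `c`.
  obtain ⟨b, hb⟩ : ∃ b, ∀ t, edgeSum E₀ (Function.update x c t) = t * a + b :=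
    ⟨_, fun t => edgeSum_update E₀ x c t⟩
  have hxE₀ : edgeSum E₀ x = x c * a + b := by
    rw [← hb, Function.update_eq_self]
  have hyE₀ : edgeSum E₀ y = y c * a + b := by
    rw [← hb]
    refine edgeSum_congr h.edge_subset fun v hv => ?_
    by_cases hvc : v = c
    · rw [hvc, Function.update_self]
    · rw [Function.update_of_ne hvc, hyV₀ v hv hvc]
  have hyca : y c * a = -(|a| * |x q|) := by
    rw [hyc]
    linear_combination |x q| * hs'
  have hca : y c * a ≤ x c * a := by
    rw [hyca]
    refine neg_le.1 ((neg_le_abs _).trans ?_)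
    rw [abs_mul, mul_comm]
    exact mul_le_mul_of_nonneg_left (hmax c (h.subset h.center_mem)) (abs_nonneg a)
  have hGsum : edgeSum (E₀ ∪ E₁) x = x c * a + b + ∑ e ∈ E₁, ∏ v ∈ e, x v := by
    rw [← hxE₀]
    exact Finset.sum_union h.disjoint_edges
  have hHsum : edgeSum (starEdges E₀ E₁ p c q) y =
      y c * a + b + ∑ e ∈ E₁, -(|x q| * ∏ v ∈ e.erase (p e), |x v|) := by
    rw [← hyE₀, ← Finset.sum_congr rfl hstar]
    have := h.sum_starEdges (fun _ => True) (fun f => ∏ v ∈ f, y v)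
    simpa only [Finset.filter_true, edgeSum] using this
  have hk0 : (0 : ℝ) < k := Nat.cast_pos.2 (by omega)
  have hsum_le := Finset.sum_le_sum hterm
  have hHG : edgeSum (starEdges E₀ E₁ p c q) y ≤ edgeSum (E₀ ∪ E₁) x := by
    rw [hGsum, hHsum]; linarith
  have hby := hbH y
  rw [hnorm] at hby
  have hx' : lam * ∑ v ∈ V, x v ^ k = k * edgeSum (E₀ ∪ E₁) x := hx
  have hkle := mul_le_mul_of_nonneg_left hHG hk0.le
  have hlam : lamH = lam := by
    refine le_antisymm (le_of_mul_le_mul_right ?_ hpos) hle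
    linarith
  rw [hlam] at hby
  have heq : edgeSum (starEdges E₀ E₁ p c q) y = edgeSum (E₀ ∪ E₁) x :=
    mul_left_cancel₀ hk0.ne' (by linarith)
  have heq' := heq
  rw [hGsum, hHsum] at heq'
  have hsum_eq : ∑ e ∈ E₁, -(|x q| * ∏ v ∈ e.erase (p e), |x v|) = ∑ e ∈ E₁, ∏ v ∈ e, x v := by
    linarith
  have hterm_eq := (Finset.sum_eq_sum_iff_of_le hterm).1 hsum_eq
  refine ⟨hlam, y, ?_, hycq, hyV₀, by linarith, by linarith, fun e he => ?_⟩
  · unfold AttainsRayleigh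
    rw [hnorm, heq, hx']
  · exact ⟨(hterm_eq e he).symm, (hstar e he).trans (hterm_eq e he)⟩

/-- A minimizer for the star hypergraph that is nonzero at the center vanishes nowhere on the
star. -/
lemma prod_starEdge_ne_zero (h : IsRootedAttachment k V V₀ E₀ E₁ p c q) (hk : Even k)
    (hbH : IsRayleighBound k V (starEdges E₀ E₁ p c q) lam) {y : α → ℝ}
    (hy : AttainsRayleigh k V (starEdges E₀ E₁ p c q) lam y) (hyc : y c ≠ 0) {e : Finset α}
    (he : e ∈ E₁) : ∏ v ∈ insert c (leaves p c q e), y v ≠ 0 := by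
  have hmem : insert c (leaves p c q e) ∈ starEdges E₀ E₁ p c q :=
    Finset.mem_union_right _ (Finset.mem_image_of_mem _ he)
  -- The leaves of a star edge are in no other edge.
  have huniq : ∀ f ∈ starEdges E₀ E₁ p c q, f ≠ insert c (leaves p c q e) →
      ∀ v ∈ leaves p c q e, v ∉ f := by
    intro f hf hne v hv hvf
    rcases Finset.mem_union.1 hf with hf | hf
    · exact h.leaves_notMem he hv (h.edge_subset f hf hvf)
    · obtain ⟨g, hg, rfl⟩ := Finset.mem_image.1 hf
      have hge : g ≠ e := by
        rintro rfl
        exact hne rfl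
      rcases Finset.mem_insert.1 hvf with rfl | hvg
      · exact h.center_notMem_leaves he hv
      · exact Finset.disjoint_left.1 (h.disjoint_leaves hg he hge) hvg hv
  have hlam : lam < 0 := hbH.neg hk h.two_le h.card_starEdges ⟨_, hmem⟩
  obtain ⟨v, hve, hvc, hv0⟩ := hy.not_vanish hk h.two_le hbH hmem (h.starEdges_subset _ hmem)
    (h.card_starEdge he) (Finset.mem_insert_self _ _) hyc fun f hf hne ⟨w, hwf, hwe, hwc⟩ =>
      absurd hwf (huniq f hf hne w (Finset.mem_of_mem_insert_of_ne hwe hwc))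
  have hvl := Finset.mem_of_mem_insert_of_ne hve hvc
  have hk0 : k ≠ 0 := by have := h.two_le; omega
  have heig := hy.eigen_mul hk0 hbH (h.starEdges_subset _ hmem hve)
  rw [Finset.sum_eq_single_of_mem _ (Finset.mem_filter.2 ⟨hmem, hve⟩)] at heig
  · rw [← heig]
    exact mul_ne_zero hlam.ne (pow_ne_zero _ hv0)
  · intro f hf hne
    exact absurd (Finset.mem_filter.1 hf).2 (huniq f (Finset.mem_filter.1 hf).1 hne v hvl)

/-- If `q ∉ V₀` and all tree edges contain `q`, a minimizer `x` that is nonzero at `c` and critical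
for the edge polynomial of `E₀` at `c` forces `c` to be isolated in `E₀`: the restriction of `x` to
the complement of `V₀ \ {c}` is then also a minimizer, but it vanishes on the neighbours of `c` in
`V₀`. -/
lemma center_isolated (h : IsRootedAttachment k V V₀ E₀ E₁ p c q) (hk : Even k)
    (hb : IsRayleighBound k V (E₀ ∪ E₁) lam) (hx : AttainsRayleigh k V (E₀ ∪ E₁) lam x)
    (hq : ∀ e ∈ E₁, q ∈ e) (hqV₀ : q ∉ V₀) (hxc : x c ≠ 0) (ha : edgeDeriv E₀ x c = 0) :
    ∀ e ∈ E₀, c ∉ e := by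
  intro e₀ he₀ hce₀
  have hk2 := h.two_le
  have hout : ∀ e ∈ E₁, ∀ v ∈ e, v ∈ V₀ → v = c := by
    intro e he v hv hvV
    by_contra hvc
    have hqp : q = p e := by
      by_contra hne
      exact ((h.cover q).2 ⟨e, he, Finset.mem_erase.2 ⟨hne, hq e he⟩⟩).2
        (Finset.mem_insert_self _ _)
    have hvp : v ≠ p e := by
      rintro rfl
      exact hqV₀ (hqp ▸ hvV)
    exact ((h.cover v).2 ⟨e, he, Finset.mem_erase.2 ⟨hvp, hv⟩⟩).2
      (Finset.mem_insert_of_mem (Finset.mem_erase.2 ⟨hvc, hvV⟩))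
  have hcardE : ∀ e ∈ E₀ ∪ E₁, e.card = k := fun e he =>
    (Finset.mem_union.1 he).elim (h.card_edge e) (h.card_branch e)
  let x' : α → ℝ := fun v => if v ∈ V₀.erase c then 0 else x v
  -- The eigenvalue equations on `V₀ \ {c}`, summed up.
  have hcrit : lam * ∑ v ∈ V₀.erase c, x v ^ k = k * edgeSum E₀ x := by
    have h1 : ∀ v ∈ V₀.erase c, lam * x v ^ k = ∑ e ∈ E₀ with v ∈ e, ∏ w ∈ e, x w := by
      intro v hv
      have hvV := Finset.mem_of_mem_erase hv
      rw [hx.eigen_mul (by omega) hb (h.subset hvV), Finset.filter_union,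
        Finset.filter_false_of_mem (s := E₁), Finset.union_empty]
      exact fun e he hve => Finset.ne_of_mem_erase hv (hout e he v hve hvV)
    have h2 : ∑ e ∈ E₀ with c ∈ e, ∏ w ∈ e, x w = 0 := by
      rw [← mul_edgeDeriv, ha, mul_zero]
    rw [Finset.mul_sum, Finset.sum_congr rfl h1, ← zero_add (∑ v ∈ V₀.erase c, _), ← h2,
      Finset.add_sum_erase V₀ (fun v => ∑ e ∈ E₀ with v ∈ e, ∏ w ∈ e, x w) h.center_mem]
    simp_rw [Finset.sum_filter]
    rw [Finset.sum_comm, edgeSum, Finset.mul_sum]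
    refine Finset.sum_congr rfl fun e he => ?_
    rw [← Finset.sum_filter, Finset.sum_const, nsmul_eq_mul, Finset.filter_mem_eq_inter,
      Finset.inter_eq_right.2 (h.edge_subset e he), h.card_edge e he]
  have hx' : AttainsRayleigh k V (E₀ ∪ E₁) lam x' := by
    have hsub : V₀.erase c ⊆ V := (Finset.erase_subset _ _).trans h.subset
    have hn : ∑ v ∈ V, x' v ^ k = ∑ v ∈ V, x v ^ k - ∑ v ∈ V₀.erase c, x v ^ k := by
      rw [← Finset.sum_sdiff hsub, ← Finset.sum_sdiff hsub (f := fun v => x v ^ k)]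
      have h1 : ∑ v ∈ V₀.erase c, x' v ^ k = 0 := Finset.sum_eq_zero fun v hv => by
        simp only [x', if_pos hv]
        exact zero_pow (by omega)
      have h2 : ∑ v ∈ V \ V₀.erase c, x' v ^ k = ∑ v ∈ V \ V₀.erase c, x v ^ k :=
        Finset.sum_congr rfl fun v hv => by
          simp only [x', if_neg (Finset.mem_sdiff.1 hv).2]
      rw [h1, h2]
      ring
    have hs : edgeSum (E₀ ∪ E₁) x' = edgeSum (E₀ ∪ E₁) x - edgeSum E₀ x := by
      unfold edgeSum
      rw [Finset.sum_union h.disjoint_edges, Finset.sum_union h.disjoint_edges]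
      have h1 : ∑ e ∈ E₀, ∏ v ∈ e, x' v = 0 := Finset.sum_eq_zero fun e he => by
        obtain ⟨v, hv, hvc⟩ := Finset.exists_mem_ne (by rw [h.card_edge e he]; omega) c
        exact Finset.prod_eq_zero hv
          (if_pos (Finset.mem_erase.2 ⟨hvc, h.edge_subset e he hv⟩))
      have h2 : ∑ e ∈ E₁, ∏ v ∈ e, x' v = ∑ e ∈ E₁, ∏ v ∈ e, x v :=
        Finset.sum_congr rfl fun e he => Finset.prod_congr rfl fun v hv => if_neg fun hv' =>
          Finset.ne_of_mem_erase hv' (hout e he v hv (Finset.mem_of_mem_erase hv'))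
      rw [h1, h2]
      ring
    have hx0 : lam * ∑ v ∈ V, x v ^ k = k * edgeSum (E₀ ∪ E₁) x := hx
    unfold AttainsRayleigh
    rw [hn, hs, mul_sub, mul_sub, hx0, hcrit]
  have hx'c : x' c ≠ 0 := by
    simp only [x']
    rwa [if_neg (Finset.notMem_erase c V₀)]
  have hx'0 : ∀ v ∈ V₀, v ≠ c → x' v = 0 := fun v hv hvc =>
    if_pos (Finset.mem_erase.2 ⟨hvc, hv⟩)
  obtain ⟨v, hv, hvc, hv0⟩ := hx'.not_vanish hk hk2 hb (Finset.mem_union_left _ he₀)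
    ((h.edge_subset e₀ he₀).trans h.subset) (h.card_edge e₀ he₀) hce₀ hx'c (by
      rintro f hf hne ⟨w, hwf, hwe, hwc⟩
      obtain ⟨v, hvf, hve⟩ : ∃ v ∈ f, v ∉ e₀ := by
        by_contra! hsub
        exact hne (Finset.eq_of_subset_of_card_le hsub (by rw [h.card_edge e₀ he₀, hcardE f hf]))
      rcases Finset.mem_union.1 hf with hf | hf
      · exact ⟨v, hvf, hve, hx'0 v (h.edge_subset f hf hvf) (ne_of_mem_of_not_mem hce₀ hve).symm⟩
      · exact absurd (hout f hf w hwf (h.edge_subset e₀ he₀ hwe)) hwc)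
  exact hv0 (hx'0 v (h.edge_subset e₀ he₀ hv) hvc)

/-- If replacing the trees by a star does not lower the least eigenvalue, then all tree edges
contain `q`, the vertex where the minimizer `x` is largest, and if `q ∉ V₀`, then `c` is isolated in
`E₀`. The eigenvalue equation of the star hypergraph at `c` has a contribution from every tree edge,
that of `G` at `q` only from those containing `q`, and everything else in these equations agrees. -/
theorem root_mem_of_le (h : IsRootedAttachment k V V₀ E₀ E₁ p c q) (hk : Even k)
    (hb : IsRayleighBound k V (E₀ ∪ E₁) lam) (hx : AttainsRayleigh k V (E₀ ∪ E₁) lam x)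
    (hxq : x q ≠ 0) (hmax : ∀ v ∈ V, |x v| ≤ |x q|) (hlt : q ∉ V₀ → |x c| < |x q|)
    (hbH : IsRayleighBound k V (starEdges E₀ E₁ p c q) lamH) (hle : lam ≤ lamH) :
    (∀ e ∈ E₁, q ∈ e) ∧ (q ∉ V₀ → ∀ e ∈ E₀, c ∉ e) := by
  have hk0 : k ≠ 0 := by have := h.two_le; omega
  obtain ⟨hlam, y, hy, hyc, hyV₀, hay, ha, hE₁⟩ := h.exists_star_vector hk hx hxq hmax hbH hle
  rw [hlam] at hbH
  have hyc0 : y c ≠ 0 := abs_ne_zero.1 (by rw [hyc]; exact abs_ne_zero.2 hxq)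
  have hne : ∀ e ∈ E₁, ∏ v ∈ e, x v ≠ 0 := fun e he => by
    rw [← (hE₁ e he).2]
    exact h.prod_starEdge_ne_zero hk hbH hy hyc0 he
  have hneg : ∀ e ∈ E₁, ∏ v ∈ e, x v < 0 := fun e he => by
    refine lt_of_le_of_ne ?_ (hne e he)
    rw [(hE₁ e he).1]
    exact neg_nonpos.2 (mul_nonneg (abs_nonneg _) (Finset.prod_nonneg fun _ _ => abs_nonneg _))
  have ha0 : q ∉ V₀ → edgeDeriv E₀ x c = 0 := by
    intro hq
    by_contra hne0
    have h1 : x c * edgeDeriv E₀ x c ≥ -(|edgeDeriv E₀ x c| * |x c|) := by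
      have := neg_abs_le (x c * edgeDeriv E₀ x c)
      rwa [abs_mul, mul_comm |x c|] at this
    have h2 := mul_lt_mul_of_pos_left (hlt hq) (abs_pos.2 hne0)
    linarith
  have hH : lam * x q ^ k = y c * edgeDeriv E₀ x c + ∑ e ∈ E₁, ∏ v ∈ e, x v := by
    have h1 : edgeDeriv E₀ x c = edgeDeriv E₀ y c :=
      Finset.sum_congr rfl fun e he => Finset.prod_congr rfl fun v hv =>
        (hyV₀ v (h.edge_subset e (Finset.mem_filter.1 he).1 (Finset.mem_of_mem_erase hv))
          (Finset.ne_of_mem_erase hv)).symm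
    rw [← hk.pow_abs, ← hyc, hk.pow_abs, hy.eigen_mul hk0 hbH (h.subset h.center_mem),
      h.sum_starEdges, h1, mul_edgeDeriv]
    congr 1
    rw [Finset.filter_true_of_mem fun e _ => Finset.mem_insert_self _ _]
    exact Finset.sum_congr rfl fun e he => (hE₁ e he).2
  have hG : lam * x q ^ k = y c * edgeDeriv E₀ x c + ∑ e ∈ E₁ with q ∈ e, ∏ v ∈ e, x v := by
    rw [hx.eigen_mul hk0 hb h.root_mem, Finset.filter_union,
      Finset.sum_union (Finset.disjoint_filter_filter h.disjoint_edges)]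
    congr 1
    rcases h.root_eq_or with rfl | hq
    · rw [← hay, mul_edgeDeriv]
    · rw [ha0 hq, mul_zero, Finset.filter_false_of_mem, Finset.sum_empty]
      exact fun e he hqe => hq (h.edge_subset e he hqe)
  have hall : ∀ e ∈ E₁, q ∈ e := by
    have hsplit := Finset.sum_filter_add_sum_filter_not E₁ (fun e => q ∈ e) fun e => ∏ v ∈ e, x v
    have h0 : ∑ e ∈ E₁ with q ∉ e, ∏ v ∈ e, x v = 0 := by linarith
    intro e he
    by_contra hqe
    refine hne e he ((Finset.sum_eq_zero_iff_of_nonpos fun f hf => ?_).1 h0 e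
      (Finset.mem_filter.2 ⟨he, hqe⟩))
    exact (hneg f (Finset.mem_filter.1 hf).1).le
  refine ⟨hall, fun hq => h.center_isolated hk hb hx hall hq ?_ (ha0 hq)⟩
  have hcq : c ≠ q := fun hcq => hq (hcq ▸ h.center_mem)
  obtain ⟨e, he, hce⟩ := (h.cover c).1 ⟨h.subset h.center_mem, by simp [hcq]⟩
  exact Finset.prod_ne_zero_iff.1 (hne e he) c (Finset.mem_of_mem_erase hce)

end IsRootedAttachment

end Star

/-! ### The minimizing hypergraphs -/

lemma two_le_of_even {k : ℕ} [NeZero k] (hk : Even k) : 2 ≤ k := by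
  have := NeZero.ne k
  obtain ⟨r, rfl⟩ := hk
  omega

lemma IsTreeAttachment.finite {k : ℕ} {G₀ G : Hypergraph α} (h : IsTreeAttachment k G₀ G)
    (hfin : G₀.vertexSet.Finite) : G.vertexSet.Finite := by
  obtain ⟨n, T, r, hT, -, -, hV, -⟩ := h
  rw [hV]
  exact hfin.union (Set.finite_iUnion fun i => (hT i).finite)

lemma IsCoalescence.notMem_edgeSet {k : ℕ} (hk : 2 ≤ k) {G₁ G₂ G : Hypergraph α} {u : α}
    (h : IsCoalescence G₁ G₂ u G) (hu : G₂.IsUniform k) {e : Set α} (he : e ∈ G₂.edgeSet) :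
    e ∉ G₁.edgeSet := fun he' => by
  refine not_subset_singleton hk (hu e he) u fun v hv => ?_
  rw [← h.inter_eq]
  exact ⟨mem_vertexSet_of_mem_edgeSet he' hv, mem_vertexSet_of_mem_edgeSet he hv⟩

lemma IsHyperstar.mem_attachmentClass {k m : ℕ} (hk : 2 ≤ k) {G₀ S G : Hypergraph α} {u : α}
    (hfin : G₀.vertexSet.Finite) (hS : IsHyperstar k m u S) (h : IsCoalescence G₀ S u G) :
    G ∈ attachmentClass k m G₀ := by
  refine ⟨⟨1, fun _ => S, fun _ => u, fun _ => hS.isHypertree, fun _ => h.inter_eq,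
    fun i j hij => absurd (Subsingleton.elim i j) hij, ?_, ?_⟩, ?_⟩
  · rw [h.vertexSet_eq, Set.iUnion_const]
  · rw [h.edgeSet_eq, Set.iUnion_const]
  · have h₀ : G₀.edgeSet.Finite :=
      hfin.finite_subsets.subset fun e he => subset_vertexSet_of_mem_edgeSet he
    have h₁ : S.edgeSet.Finite :=
      hS.finite.finite_subsets.subset fun e he => subset_vertexSet_of_mem_edgeSet he
    rw [h.edgeSet_eq, Set.ncard_union_eq _ h₀ h₁, hS.card_edges]
    exact Set.disjoint_right.2 fun e he => h.notMem_edgeSet hk hS.uniform he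

/-- The center of an attached hyperstar with an edge is determined by the resulting hypergraph. -/
lemma IsHyperstar.center_unique {k m : ℕ} (hk : 2 ≤ k) (hm : 1 ≤ m) {G₀ S S' G : Hypergraph α}
    {u u' : α} (h : IsCoalescence G₀ S u G)
    (hS' : IsHyperstar k m u' S') (h' : IsCoalescence G₀ S' u' G) : u' = u := by
  obtain ⟨e, he⟩ : S'.edgeSet.Nonempty :=
    Set.nonempty_of_ncard_ne_zero (by rw [hS'.card_edges]; omega)
  have heG : e ∈ G₀.edgeSet ∪ S.edgeSet := by
    rw [← h.edgeSet_eq, h'.edgeSet_eq]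
    exact Or.inr he
  have heS := heG.resolve_left (h'.notMem_edgeSet hk hS'.uniform he)
  have hu' : u' ∈ G₀.vertexSet ∩ S'.vertexSet := by rw [h'.inter_eq]; rfl
  have : u' ∈ G₀.vertexSet ∩ S.vertexSet :=
    ⟨hu'.1, mem_vertexSet_of_mem_edgeSet heS (hS'.center_mem e he)⟩
  rwa [h.inter_eq] at this

lemma IsConnected.exists_edge_mem {k : ℕ} (hk : 2 ≤ k) {G : Hypergraph α} (hG : G.IsConnected)
    (hu : G.IsUniform k) (hE : G.edgeSet.Nonempty) {c : α} (hc : c ∈ G.vertexSet) :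
    ∃ e ∈ G.edgeSet, c ∈ e := by
  obtain ⟨e, he⟩ := hE
  obtain ⟨v, hv, hvc⟩ := Set.not_subset.1 (not_subset_singleton hk (hu e he) c)
  rcases (hG.2 c hc v (mem_vertexSet_of_mem_edgeSet he hv)).cases_head with
    h | ⟨w, ⟨f, hf, hcf, -⟩, -⟩
  · exact absurd h.symm hvc
  · exact ⟨f, hf, hcf⟩

lemma IsConnected.vertexSet_eq_singleton {G : Hypergraph α} (hG : G.IsConnected)
    (hE : G.edgeSet = ∅) {c : α} (hc : c ∈ G.vertexSet) : G.vertexSet = {c} := by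
  refine Set.eq_singleton_iff_unique_mem.2 ⟨hc, fun v hv => ?_⟩
  rcases (hG.2 c hc v hv).cases_head with h | ⟨w, ⟨f, hf, -⟩, -⟩
  · exact h.symm
  · rw [hE] at hf
    exact absurd hf (Set.notMem_empty f)

/-- Replacing the trees by a star at `c` stays in the class `𝒯_m(G₀)`. -/
lemma IsRootedAttachment.exists_mem_attachmentClass [DecidableEq α] {k m : ℕ} {V V₀ : Finset α}
    {E₀ E₁ : Finset (Finset α)} {p : Finset α → α} {c q : α}
    (h : IsRootedAttachment k V V₀ E₀ E₁ p c q) {G₀ : Hypergraph α} (h₀ : IsModel G₀ V₀ E₀)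
    (hm : E₁.card = m) :
    ∃ H ∈ attachmentClass k m G₀, IsModel H V (starEdges E₀ E₁ p c q) := by
  have hk := h.two_le
  have hcV := h.subset h.center_mem
  have hfin : G₀.vertexSet.Finite := by rw [h₀.vertexSet_eq]; exact V₀.finite_toSet
  let S : Hypergraph α :=
    { vertexSet := insert c {v | v ∈ V ∧ v ∉ V₀}
      edgeSet := {s | ∃ e ∈ E₁, ((insert c (leaves p c q e) : Finset α) : Set α) = s}
      subset_vertexSet_of_mem_edgeSet' := by
        rintro s ⟨e, he, rfl⟩ v hv
        rcases Finset.mem_insert.1 (Finset.mem_coe.1 hv) with rfl | hv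
        · exact Set.mem_insert _ _
        · exact Set.mem_insert_of_mem _ (h.mem_leaves_iff.2 ⟨e, he, hv⟩) }
  let H : Hypergraph α :=
    { vertexSet := V
      edgeSet := {s | ∃ e ∈ starEdges E₀ E₁ p c q, (e : Set α) = s}
      subset_vertexSet_of_mem_edgeSet' := by
        rintro s ⟨e, he, rfl⟩
        exact Finset.coe_subset.2 (h.starEdges_subset e he) }
  have hSE : ∀ s, s ∈ S.edgeSet ↔
      ∃ e ∈ E₁, ((insert c (leaves p c q e) : Finset α) : Set α) = s := fun _ => Iff.rfl
  have hSV : ∀ v, v ∈ S.vertexSet ↔ v = c ∨ (v ∈ V ∧ v ∉ V₀) := fun _ => Iff.rfl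
  have hS : IsHyperstar k m c S := by
    refine ⟨?_, ?_, ?_, ?_, ?_, ?_⟩
    · refine V.finite_toSet.subset fun v hv => ?_
      rcases (hSV v).1 hv with rfl | hv
      · exact hcV
      · exact hv.1
    · rintro s ⟨e, he, rfl⟩
      rw [Set.ncard_coe_finset]
      exact h.card_starEdge he
    · have : S.edgeSet =
          (fun e => ((insert c (leaves p c q e) : Finset α) : Set α)) '' (E₁ : Set _) := rfl
      rw [this, Set.InjOn.ncard_image, Set.ncard_coe_finset, hm]
      exact fun e he f hf hef => h.starEdge_inj he hf (Finset.coe_injective hef)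
    · rintro s ⟨e, he, rfl⟩
      exact Finset.mem_coe.2 (Finset.mem_insert_self _ _)
    · rintro s ⟨e, he, rfl⟩ t ⟨f, hf, rfl⟩ hne
      have hef : e ≠ f := by
        rintro rfl
        exact hne rfl
      have hd := h.disjoint_leaves he hf hef
      rw [← Finset.coe_inter, ← Finset.insert_inter_distrib,
        Finset.disjoint_iff_inter_eq_empty.1 hd]
      simp
    · ext v
      rw [hSV, h.mem_leaves_iff, Set.mem_insert_iff, Set.mem_sUnion]
      constructor
      · rintro (rfl | ⟨e, he, hv⟩)
        · exact Or.inl rfl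
        · exact Or.inr ⟨_, ⟨e, he, rfl⟩, Finset.mem_coe.2 (Finset.mem_insert_of_mem hv)⟩
      · rintro (rfl | ⟨_, ⟨e, he, rfl⟩, hv⟩)
        · exact Or.inl rfl
        · rcases Finset.mem_insert.1 (Finset.mem_coe.1 hv) with rfl | hv
          · exact Or.inl rfl
          · exact Or.inr ⟨e, he, hv⟩
  have hH : IsCoalescence G₀ S c H := by
    refine ⟨?_, ?_, ?_⟩
    · ext v
      rw [h₀.vertexSet_eq, Set.mem_inter_iff, hSV, Finset.mem_coe, Set.mem_singleton_iff]
      constructor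
      · rintro ⟨hv, rfl | hv'⟩
        · rfl
        · exact absurd hv hv'.2
      · rintro rfl
        exact ⟨h.center_mem, Or.inl rfl⟩
    · ext v
      rw [h₀.vertexSet_eq, Set.mem_union, hSV, Finset.mem_coe]
      constructor
      · intro hv
        by_cases hv0 : v ∈ V₀
        · exact Or.inl hv0
        · exact Or.inr (Or.inr ⟨hv, hv0⟩)
      · rintro (hv | rfl | hv)
        · exact h.subset hv
        · exact hcV
        · exact hv.1
    · ext s
      rw [Set.mem_union, hSE, h₀.mem_edgeSet]
      constructor
      · rintro ⟨e, he, rfl⟩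
        rcases Finset.mem_union.1 he with he | he
        · exact Or.inl ⟨e, he, rfl⟩
        · obtain ⟨f, hf, rfl⟩ := Finset.mem_image.1 he
          exact Or.inr ⟨f, hf, rfl⟩
      · rintro (⟨e, he, rfl⟩ | ⟨e, he, rfl⟩)
        · exact ⟨e, Finset.mem_union_left _ he, rfl⟩
        · exact ⟨_, Finset.mem_union_right _ (Finset.mem_image_of_mem _ he), rfl⟩
  exact ⟨H, hS.mem_attachmentClass hk hfin hH, rfl, fun s => Iff.rfl⟩

/-- In a minimizing hypergraph, the edges outside `G₀` form a hyperstar, attached to `G₀` at its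
center. If `G₀` is a single vertex, the center of the star may also be another vertex. -/
theorem IsMinimizing.exists_star {k m : ℕ} [NeZero k] (hk : Even k) {G₀ G : Hypergraph α}
    (hfin : G₀.vertexSet.Finite) (hunif : G₀.IsUniform k) (hconn : G₀.IsConnected)
    (hG : IsMinimizing k (attachmentClass k m G₀) G) :
    ∃ q S, IsHyperstar k m q S ∧
      ((q ∈ G₀.vertexSet ∧ IsCoalescence G₀ S q G) ∨ (G₀.edgeSet = ∅ ∧ G = S)) := by
  classical
  have hk2 := two_le_of_even hk
  obtain ⟨⟨hatt, hcardG⟩, hmin⟩ := hG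
  have hGfin := hatt.finite hfin
  obtain ⟨V, E, hV⟩ := exists_isModel hGfin
  have hmemV : ∀ v, v ∈ G.vertexSet ↔ v ∈ V := fun v => by rw [hV.vertexSet_eq]; rfl
  set V₀ := hfin.toFinset with hV₀
  have hmemV₀ : ∀ v, v ∈ V₀ ↔ v ∈ G₀.vertexSet := fun v => hfin.mem_toFinset
  have hsub : G₀.vertexSet ⊆ G.vertexSet := by
    obtain ⟨n, T, r, -, -, -, h, -⟩ := hatt
    rw [h]
    exact Set.subset_union_left
  have huG : G.IsUniform k := by
    obtain ⟨n, T, r, hT, -, -, -, h⟩ := hatt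
    intro e he
    rw [h] at he
    rcases he with he | he
    · exact hunif e he
    · obtain ⟨i, hi⟩ := Set.mem_iUnion.1 he
      exact (hT i).uniform e hi
  obtain ⟨hb, x, ⟨v₀, hv₀, hxv₀⟩, hx⟩ :=
    leastHEigenvalue_spec hk hV huG (hconn.1.mono hsub)
  -- A vertex `q` where `|x|` is largest, chosen in `G₀` if possible.
  obtain ⟨q, hqV, hmax, hlt⟩ : ∃ q ∈ V, (∀ v ∈ V, |x v| ≤ |x q|) ∧
      (q ∉ V₀ → ∀ v ∈ V₀, |x v| < |x q|) := by
    obtain ⟨q, hq, hmax⟩ := V.exists_max_image (fun v => |x v|) ⟨v₀, hv₀⟩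
    by_cases hex : ∃ v ∈ V₀, |x q| ≤ |x v|
    · obtain ⟨v, hv, hle⟩ := hex
      exact ⟨v, (hmemV v).1 (hsub ((hmemV₀ v).1 hv)), fun w hw => (hmax w hw).trans hle,
        fun h => absurd hv h⟩
    · push Not at hex
      exact ⟨q, hq, hmax, fun _ => hex⟩
  have hxq : x q ≠ 0 := abs_pos.1 ((abs_pos.2 hxv₀).trans_le (hmax v₀ hv₀))
  obtain ⟨c, hc, hcq, F, p, hEF, hcardF, hout, hp⟩ :=
    hatt.exists_isParentMap hk2 ((hmemV q).2 hqV)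
  set E₀ := E.filter fun e : Finset α => (e : Set α) ∈ G₀.edgeSet with hE₀
  set E₁ := E.filter fun e : Finset α => (e : Set α) ∈ F with hE₁
  have hmemE₁ : ∀ e : Finset α, e ∈ E₁ ↔ (e : Set α) ∈ F := fun e => by
    rw [hE₁, Finset.mem_filter, ← hV.coe_mem, hEF]
    exact ⟨fun h => h.2, fun h => ⟨Or.inr h, h⟩⟩
  have hmemE₀ : ∀ e : Finset α, e ∈ E₀ ↔ (e : Set α) ∈ G₀.edgeSet := fun e => by
    rw [hE₀, Finset.mem_filter, ← hV.coe_mem, hEF]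
    exact ⟨fun h => h.2, fun h => ⟨Or.inl h, h⟩⟩
  have hE : E = E₀ ∪ E₁ := by
    ext e
    rw [Finset.mem_union, hmemE₀, hmemE₁, ← hV.coe_mem, hEF]
    rfl
  have hlift : ∀ s ∈ G.edgeSet, ∃ e : Finset α, (e : Set α) = s := fun s hs => by
    obtain ⟨e, -, he⟩ := (hV.mem_edgeSet s).1 hs
    exact ⟨e, he⟩
  have hliftF : ∀ s, s ∈ F ↔ ∃ e ∈ E₁, (e : Set α) = s := by
    intro s
    constructor
    · intro hs
      obtain ⟨e, rfl⟩ := hlift s (hEF ▸ Or.inr hs)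
      exact ⟨e, (hmemE₁ e).2 hs, rfl⟩
    · rintro ⟨e, he, rfl⟩
      exact (hmemE₁ e).1 he
  have h₀ : IsModel G₀ V₀ E₀ := by
    refine ⟨by simp [hV₀], fun s => ⟨fun hs => ?_, ?_⟩⟩
    · obtain ⟨e, rfl⟩ := hlift s (hEF ▸ Or.inl hs)
      exact ⟨e, (hmemE₀ e).2 hs, rfl⟩
    · rintro ⟨e, he, rfl⟩
      exact (hmemE₀ e).1 he
  have h : IsRootedAttachment k V V₀ E₀ E₁ (fun e => p e) c q :=
    { two_le := hk2
      subset := fun v hv => (hmemV v).1 (hsub ((hmemV₀ v).1 hv))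
      edge_subset := h₀.subset
      card_edge := h₀.card hunif
      branch_subset := fun e he => hV.subset e (Finset.mem_filter.1 he).1
      card_branch := fun e he => hV.card huG e (Finset.mem_filter.1 he).1
      branch_not_subset := fun e he hsub => hout e ((hmemE₁ e).1 he) fun v hv =>
        (hmemV₀ v).1 (hsub hv)
      center_mem := (hmemV₀ c).2 hc
      root_mem := hqV
      root_eq := fun hq => hcq ((hmemV₀ q).1 hq)
      parent_mem := fun e he => hp.mem e ((hmemE₁ e).1 he)
      disjoint := fun e he f hf hef => by
        have := hp.disjoint e ((hmemE₁ e).1 he) f ((hmemE₁ f).1 hf)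
          fun heq => hef (Finset.coe_injective heq)
        rwa [← Finset.coe_erase, ← Finset.coe_erase, Finset.disjoint_coe] at this
      cover := fun v => by
        have h1 : (v ∈ V ∧ v ∉ insert q (V₀.erase c)) ↔
            v ∈ G.vertexSet \ insert q (G₀.vertexSet \ {c}) := by
          simp only [Set.mem_sdiff, Set.mem_insert_iff, Set.mem_singleton_iff, hmemV,
            Finset.mem_insert, Finset.mem_erase, hmemV₀, and_comm]
        rw [h1, hp.cover]
        constructor
        · rintro ⟨s, hs, hv⟩
          obtain ⟨e, he, rfl⟩ := (hliftF s).1 hs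
          exact ⟨e, he, Finset.mem_erase.2 ⟨hv.2, hv.1⟩⟩
        · rintro ⟨e, he, hv⟩
          exact ⟨e, (hmemE₁ e).1 he, Finset.mem_of_mem_erase hv, Finset.ne_of_mem_erase hv⟩ }
  have hdisj : Disjoint E₀ E₁ := h.disjoint_edges
  have hcardE₁ : E₁.card = m := by
    rw [hV.ncard_edgeSet, h₀.ncard_edgeSet, hE, Finset.card_union_of_disjoint hdisj] at hcardG
    omega
  obtain ⟨H, hH, hHV⟩ := h.exists_mem_attachmentClass h₀ hcardE₁
  have huH : H.IsUniform k := fun s hs => by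
    obtain ⟨e, he, rfl⟩ := (hHV.mem_edgeSet s).1 hs
    rw [Set.ncard_coe_finset]
    exact h.card_starEdges e he
  have hHne : H.vertexSet.Nonempty := by
    rw [hHV.vertexSet_eq]
    exact ⟨v₀, hv₀⟩
  rw [hE] at hb hx
  obtain ⟨hall, hiso⟩ := h.root_mem_of_le hk hb hx hxq hmax (fun hq => hlt hq c h.center_mem)
    (leastHEigenvalue_spec hk hHV huH hHne).1 (hmin H hH)
  -- Since `q` is no child, it is the parent in every tree edge.
  have hpq : ∀ e ∈ F, q ∈ e ∧ p e = q := by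
    intro s hs
    obtain ⟨e, he, rfl⟩ := (hliftF s).1 hs
    refine ⟨hall e he, ?_⟩
    by_contra hne
    exact ((hp.cover q).2 ⟨e, hs, hall e he, Ne.symm hne⟩).2 (Set.mem_insert _ _)
  have hFsub : ⋃₀ F ⊆ G.vertexSet := Set.sUnion_subset fun e he =>
    subset_vertexSet_of_mem_edgeSet (hEF ▸ Or.inr he)
  have hqG := (hmemV q).2 hqV
  let S : Hypergraph α :=
    { vertexSet := insert q (⋃₀ F)
      edgeSet := F
      subset_vertexSet_of_mem_edgeSet' := fun e he =>
        (Set.subset_sUnion_of_mem he).trans (Set.subset_insert _ _) }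
  have hS : IsHyperstar k m q S :=
    { finite := hGfin.subset (Set.insert_subset hqG hFsub)
      uniform := hcardF
      card_edges := by
        have : F = (fun e : Finset α => (e : Set α)) '' (E₁ : Set (Finset α)) :=
          Set.ext fun s => hliftF s
        show F.ncard = m
        rw [this, Set.ncard_image_of_injective _ Finset.coe_injective, Set.ncard_coe_finset,
          hcardE₁]
      center_mem := fun e he => (hpq e he).1
      inter_eq := fun e he f hf hef => by
        refine Set.eq_singleton_iff_unique_mem.2 ⟨⟨(hpq e he).1, (hpq f hf).1⟩, fun v hv => ?_⟩
        by_contra hvq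
        refine Set.disjoint_left.1 (hp.disjoint e he f hf hef) ⟨hv.1, ?_⟩ ⟨hv.2, ?_⟩
        · rwa [(hpq e he).2]
        · rwa [(hpq f hf).2]
      vertexSet_eq := rfl }
  have hchild : ∀ v ∈ ⋃₀ F, v ≠ q → v ∉ G₀.vertexSet \ {c} := by
    rintro v ⟨e, he, hve⟩ hvq hv
    refine ((hp.cover v).2 ⟨e, he, hve, ?_⟩).2 (Set.mem_insert_of_mem _ hv)
    rwa [(hpq e he).2]
  have hcover : ∀ v ∈ G.vertexSet, v ≠ q → v ∉ G₀.vertexSet \ {c} → v ∈ ⋃₀ F := by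
    intro v hv hvq hv0
    obtain ⟨e, he, hve⟩ := (hp.cover v).1 ⟨hv, fun h => h.elim hvq hv0⟩
    exact ⟨e, he, hve.1⟩
  refine ⟨q, S, hS, ?_⟩
  by_cases hq : q ∈ G₀.vertexSet
  · refine Or.inl ⟨hq, ?_, ?_, hEF⟩
    · refine Set.eq_singleton_iff_unique_mem.2 ⟨⟨hq, Set.mem_insert _ _⟩, fun v hv => ?_⟩
      by_contra hvq
      refine hchild v (hv.2.resolve_left hvq) hvq ⟨hv.1, ?_⟩
      rwa [hcq hq]
    · refine Set.Subset.antisymm (fun v hv => ?_)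
        (Set.union_subset hsub (Set.insert_subset hqG hFsub))
      by_cases hv0 : v ∈ G₀.vertexSet
      · exact Or.inl hv0
      · refine Or.inr (Or.inr (hcover v hv ?_ fun h => hv0 h.1))
        rintro rfl
        exact hv0 hq
  · have hE₀' : G₀.edgeSet = ∅ := by
      by_contra hne
      obtain ⟨s, hs, hcs⟩ :=
        hconn.exists_edge_mem hk2 hunif (Set.nonempty_iff_ne_empty.2 hne) hc
      obtain ⟨e, he, rfl⟩ := (h₀.mem_edgeSet s).1 hs
      exact hiso (fun hq' => hq ((hmemV₀ q).1 hq')) e he hcs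
    refine Or.inr ⟨hE₀', Hypergraph.ext ?_ (by rw [hEF, hE₀', Set.empty_union])⟩
    refine Set.Subset.antisymm (fun v hv => ?_) (Set.insert_subset hqG hFsub)
    by_cases hvq : v = q
    · exact Or.inl hvq
    · refine Or.inr (hcover v hv hvq ?_)
      rw [hconn.vertexSet_eq_singleton hE₀' hc, Set.sdiff_self]
      exact Set.notMem_empty v

end Hypergraph

theorem theorem4p2 {α : Type*} (k m : ℕ) [NeZero k] (hk : Even k) (hm : 1 ≤ m)
    (G₀ : Hypergraph α) (hfin : G₀.vertexSet.Finite) (hunif : G₀.IsUniform k)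
    (hconn : G₀.IsConnected) (G : Hypergraph α)
    (hG : Hypergraph.IsMinimizing k (Hypergraph.attachmentClass k m G₀) G) :
    (G₀.edgeSet.Nonempty →
      ∃! u, u ∈ G₀.vertexSet ∧
        ∃ S, Hypergraph.IsHyperstar k m u S ∧ Hypergraph.IsCoalescence G₀ S u G) ∧
    (G₀.edgeSet = ∅ → ∃ c, Hypergraph.IsHyperstar k m c G) := by
  have hk2 := Hypergraph.two_le_of_even hk
  obtain ⟨q, S, hS, h⟩ := hG.exists_star hk hfin hunif hconn
  constructor
  · intro hne
    obtain ⟨hq, hGS⟩ := h.resolve_right fun h => hne.ne_empty h.1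
    refine ⟨q, ⟨hq, S, hS, hGS⟩, ?_⟩
    rintro u ⟨-, S', hS', hGS'⟩
    exact Hypergraph.IsHyperstar.center_unique hk2 hm hGS hS' hGS'
  · intro hE
    rcases h with ⟨hq, hGS⟩ | ⟨-, rfl⟩
    · have hGeq : G = S := by
        refine Hypergraph.ext ?_ ?_
        · have hqS : q ∈ S.vertexSet := by rw [hS.vertexSet_eq]; exact Set.mem_insert _ _
          rw [hGS.vertexSet_eq, hconn.vertexSet_eq_singleton hE hq, Set.union_eq_right,
            Set.singleton_subset_iff]
          exact hqS
        · rw [hGS.edgeSet_eq, hE, Set.empty_union]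
      exact ⟨q, hGeq ▸ hS⟩
    · exact ⟨q, hS⟩
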